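/- Let $\mathfrak A$ be a unital $*$-algebra (an associative unital complex algebra with an antilinear involution $^*$), let $a=a^*\in\mathfrak A$, and let $\omega:\mathfrak A\to\mathbb C$ be a non-normalized state, i.e. a linear functional with $\omega(b^*b)\ge 0$ for all $b\in\mathfrak A$ and $\omega(1)\neq 0$. Let $(\mathsf H_\omega,\mathcal D_\omega,\pi_\omega,\psi_\omega)$ be a GNS quadruple of $(\mathfrak A,\omega)$: $\mathsf H_\omega$ is a complex Hilbert space, $\mathcal D_\omega\subset\mathsf H_\omega$ a dense subspace, $\pi_\omega$ a unital algebra representation of $\mathfrak A$ by operators $\pi_\omega(b):\mathcal D_\omega\to\mathcal D_\omega$ with $\pi_\omega(b^*)\subset\pi_\omega(b)^\dagger$, and $\psi_\omega\in\mathcal D_\omega$ satisfies $\mathcal D_\omega=\pi_\omega(\mathfrak A)\psi_\omega$ and $\omega(b)=\langle\psi_\omega|\pi_\omega(b)\psi_\omega\rangle$ for all $b\in\mathfrak A$. A positive Borel measure $\mu$ on $\mathbb R$ is said to solve the moment problem for $(a,\omega)$ if, for every $n\in\mathbb N=\{0,1,2,\dots\}$, $\lambda^n$ is $\mu$-integrable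 and $$\omega(a^n)=\int_{\mathbb R}\lambda^n\,d\mu(\lambda).$$ (a) Suppose that $\pi_\omega(a)$ is essentially selfadjoint. Then its closure $\overline{\pi_\omega(a)}$ has a projection-valued spectral measure $P$ on the Borel sets of $\mathbb R$, that is, $\overline{\pi_\omega(a)}=\int_{\mathbb R}\lambda\,dP(\lambda)$; and for every such $P$ the measure $\mu^{(a)}_\omega(E):=\langle\psi_\omega|P(E)\psi_\omega\rangle$ is a finite positive Borel measure that solves the moment problem for $(a,\omega)$. (b) Suppose that $\mathfrak A$ is a unital $C^*$-algebra. Then $\pi_\omega(a)$ is essentially selfadjoint, and $\mu^{(a)}_\omega$ is the unique positive Borel measure on $\mathbb R$ that solves the moment problem for $(a,\omega)$. -/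

import Mathlib

open MeasureTheory
open scoped ComplexOrder InnerProductSpace

universe u v

noncomputable section

/-- A non-normalized state on a unital `*`-algebra: a linear functional `ω` with `ω (a* a) ≥ 0`
for all `a`, and `ω 1 ≠ 0`. -/
structure NonNormalizedState (A : Type u) [Ring A] [StarRing A] [Algebra ℂ A]
    extends A →ₗ[ℂ] ℂ where
  nonneg' : ∀ a : A, 0 ≤ toFun (star a * a)
  map_one_ne_zero' : toFun 1 ≠ 0

instance {A : Type u} [Ring A] [StarRing A] [Algebra ℂ A] :
    CoeFun (NonNormalizedState A) (fun _ => A → ℂ) :=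
  ⟨fun ω => ω.toLinearMap⟩

section Operators

variable {H : Type v} [NormedAddCommGroup H] [InnerProductSpace ℂ H]

/-- A linear map `D → D` regarded as an operator in `H` with domain `D`. -/
def operatorOn (D : Submodule ℂ H) (f : Module.End ℂ D) : H →ₗ.[ℂ] H where
  domain := D
  toFun := D.subtype ∘ₗ f

/-- A densely defined Hermitian operator. -/
structure IsSymmetricOperator (T : H →ₗ.[ℂ] H) : Prop where
  dense_domain : Dense (T.domain : Set H)
  hermitian : ∀ x y : T.domain, ⟪T x, (y : H)⟫_ℂ = ⟪(x : H), T y⟫_ℂ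

/-- A symmetric operator is essentially selfadjoint if its closure is selfadjoint. -/
structure IsEssentiallySelfAdjoint [CompleteSpace H] (T : H →ₗ.[ℂ] H) : Prop where
  symmetric : IsSymmetricOperator T
  closure_selfAdjoint : IsSelfAdjoint T.closure

end Operators

section GNS

variable {A : Type u} [Ring A] [StarRing A] [Algebra ℂ A]

/-- A GNS quadruple `(H, D, π, ψ)` of `(A, ω)`. -/
structure GNSQuadruple (ω : NonNormalizedState A)
    (H : Type v) [NormedAddCommGroup H] [InnerProductSpace ℂ H] [CompleteSpace H] where
  /-- the dense subspace `D` of the Hilbert space `H` -/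
  D : Submodule ℂ H
  dense_D : Dense (D : Set H)
  /-- the unital representation by operators `D → D` -/
  π : A →ₐ[ℂ] Module.End ℂ D
  /-- `π (a*) ⊆ π (a)†` -/
  star_le_adjoint : ∀ a : A, operatorOn D (π (star a)) ≤ (operatorOn D (π a)).adjoint
  /-- the cyclic vector -/
  ψ : D
  /-- `D = π (A) ψ` -/
  cyclic : ∀ x : D, ∃ a : A, π a ψ = x
  /-- `ω (a) = ⟨ψ | π (a) ψ⟩` -/
  expectation : ∀ a : A, ω a = ⟪(ψ : H), (π a ψ : H)⟫_ℂ

/-- The operator `π_ω (a)` in the Hilbert space `H`, with domain `D`. -/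
def GNSQuadruple.op {ω : NonNormalizedState A}
    {H : Type v} [NormedAddCommGroup H] [InnerProductSpace ℂ H] [CompleteSpace H]
    (Q : GNSQuadruple ω H) (a : A) : H →ₗ.[ℂ] H :=
  operatorOn Q.D (Q.π a)

/-- `μ` solves the moment problem for `(a, ω)`: for every `n` the `n`-th moment of the Borel
measure `μ` exists and equals `ω (a ^ n)`. The case `n = 0` forces `μ` to be finite. -/
structure SolvesMomentProblem (ω : NonNormalizedState A) (a : A) (μ : Measure ℝ) : Prop where
  integrable : ∀ n : ℕ, Integrable (fun t : ℝ => t ^ n) μ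
  moment : ∀ n : ℕ, ω (a ^ n) = ((∫ t : ℝ, t ^ n ∂μ : ℝ) : ℂ)

end GNS

section PVM

/-- A (normalized) projection-valued measure on the Borel sets of `ℝ`; only the values on Borel
sets matter. -/
structure PVM (H : Type v) [NormedAddCommGroup H] [InnerProductSpace ℂ H] [CompleteSpace H] where
  proj : Set ℝ → H →L[ℂ] H
  isProj : ∀ E, MeasurableSet E → IsStarProjection (proj E)
  univ : proj Set.univ = 1
  hasSum : ∀ E : ℕ → Set ℝ, (∀ n, MeasurableSet (E n)) → Pairwise (Function.onFun Disjoint E) →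
    ∀ x : H, HasSum (fun n => proj (E n) x) (proj (⋃ n, E n) x)

variable {H : Type v} [NormedAddCommGroup H] [InnerProductSpace ℂ H] [CompleteSpace H]

theorem PVM.empty (P : PVM H) (x : H) : P.proj ∅ x = 0 := by
  have h := P.hasSum (fun _ => ∅) (fun _ => MeasurableSet.empty)
    (fun _ _ _ => disjoint_bot_left) x
  exact tendsto_nhds_unique tendsto_const_nhds h.summable.tendsto_atTop_zero

theorem PVM.inner_eq (P : PVM H) {E : Set ℝ} (hE : MeasurableSet E) (x : H) :
    ⟪x, P.proj E x⟫_ℂ = ((‖P.proj E x‖ ^ 2 : ℝ) : ℂ) := by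
  have h := P.isProj E hE
  have h1 : P.proj E (P.proj E x) = P.proj E x :=
    congrArg (fun T : H →L[ℂ] H => T x) h.isIdempotentElem
  have h2 : ContinuousLinearMap.adjoint (P.proj E) = P.proj E := h.isSelfAdjoint
  have h3 : ⟪P.proj E x, P.proj E x⟫_ℂ = ⟪x, P.proj E x⟫_ℂ := by
    rw [← ContinuousLinearMap.adjoint_inner_right, h2, h1]
  rw [← h3, inner_self_eq_norm_sq_to_K]
  push_cast
  rfl

theorem PVM.re_inner_nonneg (P : PVM H) {E : Set ℝ} (hE : MeasurableSet E) (x : H) :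
    0 ≤ (⟪x, P.proj E x⟫_ℂ).re := by
  rw [P.inner_eq hE, Complex.ofReal_re]
  positivity

/-- The positive Borel measure `E ↦ ⟨x | P (E) x⟩`. -/
def PVM.measure (P : PVM H) (x : H) : Measure ℝ :=
  Measure.ofMeasurable (fun E _ => ENNReal.ofReal (⟪x, P.proj E x⟫_ℂ).re)
    (by simp [P.empty])
    (by
      intro E hE hd
      have h := (P.hasSum E hE hd x).mapL (innerSL ℂ x)
      have h' := h.mapL Complex.reCLM
      simp only [innerSL_apply_apply, Complex.reCLM_apply] at h'
      rw [← h'.tsum_eq]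
      exact ENNReal.ofReal_tsum_of_nonneg (fun n => P.re_inner_nonneg (hE n) x) h'.summable)

theorem PVM.measure_apply (P : PVM H) (x : H) {E : Set ℝ} (hE : MeasurableSet E) :
    P.measure x E = ENNReal.ofReal (⟪x, P.proj E x⟫_ℂ).re :=
  Measure.ofMeasurable_apply E hE

/-- `P` is a spectral measure of the operator `T`, i.e. `T = ∫ t dP(t)`: the domain of `T` is
`{x | ∫ t² d⟨x|P(t)x⟩ < ∞}`, and `⟨x|Tx⟩ = ∫ t d⟨x|P(t)x⟩` there (which, by polarization and
density of the domain, determines `T`). -/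
structure PVM.IsSpectralMeasureOf (P : PVM H) (T : H →ₗ.[ℂ] H) : Prop where
  mem_domain : ∀ x : H, x ∈ T.domain ↔ Integrable (fun t : ℝ => t ^ 2) (P.measure x)
  inner_apply : ∀ x : T.domain,
    ⟪(x : H), T x⟫_ℂ = ((∫ t : ℝ, t ∂(P.measure (x : H)) : ℝ) : ℂ)

end PVM

/-! The GNS construction: every non-normalized state has a GNS quadruple, on the completion of
`A / {a | ω (a* a) = 0}`. -/

namespace NonNormalizedState

variable {A : Type u} [Ring A] [StarRing A] [Algebra ℂ A]

theorem inner_symm [StarModule ℂ A] (ω : NonNormalizedState A) (a b : A) :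
    (starRingEnd ℂ) (ω (star b * a)) = ω (star a * b) := by
  have hq : ∀ x : A, (ω (star x * x)).im = 0 := fun x =>
    ((Complex.le_def.1 (ω.nonneg' x)).2).symm
  have h1 := hq (a + b)
  have h2 := hq (a + Complex.I • b)
  have ha := hq a
  have hb := hq b
  simp only [star_add, star_smul, mul_add, add_mul, smul_mul_assoc, mul_smul_comm, map_add,
    map_smul, Complex.star_def, Complex.conj_I, smul_eq_mul, Complex.add_im, Complex.mul_im,
    Complex.mul_re, Complex.neg_re, Complex.neg_im, Complex.I_re, Complex.I_im] at h1 h2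
  apply Complex.ext
  · simp only [Complex.conj_re]; linarith
  · simp only [Complex.conj_im]; linarith

/-- `A` with the semi-inner product `⟨a | b⟩ = ω (a* b)`. -/
@[nolint unusedArguments]
def PreGNS (_ω : NonNormalizedState A) : Type u := A

variable (ω : NonNormalizedState A)

instance : AddCommGroup ω.PreGNS := inferInstanceAs (AddCommGroup A)
instance : Module ℂ ω.PreGNS := inferInstanceAs (Module ℂ A)

/-- The identity map from `A` to `A` with its semi-inner product. -/
def toPreGNS : A ≃ₗ[ℂ] ω.PreGNS := LinearEquiv.refl ℂ _

variable [StarModule ℂ A]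

/-- The semi-inner product `⟨a | b⟩ = ω (a* b)`. -/
abbrev preGNSCore : PreInnerProductSpace.Core ℂ ω.PreGNS where
  inner a b := ω (star (ω.toPreGNS.symm a) * ω.toPreGNS.symm b)
  conj_inner_symm a b := ω.inner_symm _ _
  re_inner_nonneg a := (Complex.le_def.1 (ω.nonneg' (ω.toPreGNS.symm a))).1
  add_left _ _ _ := by rw [map_add, star_add, add_mul, map_add]
  smul_left := by simp

instance : SeminormedAddCommGroup ω.PreGNS :=
  InnerProductSpace.Core.toSeminormedAddCommGroup (c := ω.preGNSCore)
instance : InnerProductSpace ℂ ω.PreGNS :=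
  InnerProductSpace.ofCore ω.preGNSCore

theorem preGNS_inner (a b : A) :
    ⟪ω.toPreGNS a, ω.toPreGNS b⟫_ℂ = ω (star a * b) := rfl

/-- The GNS Hilbert space. -/
abbrev GNSSpace : Type u := UniformSpace.Completion ω.PreGNS

/-- The map `b ↦ [b]`. -/
def gnsClass : A →ₗ[ℂ] ω.GNSSpace :=
  (UniformSpace.Completion.toComplL (𝕜 := ℂ) (E := ω.PreGNS)).toLinearMap ∘ₗ
    ω.toPreGNS.toLinearMap

theorem gnsClass_inner (a b : A) : ⟪ω.gnsClass a, ω.gnsClass b⟫_ℂ = ω (star a * b) := by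
  rw [← preGNS_inner]
  exact UniformSpace.Completion.inner_coe _ _

theorem mul_mem_ker (a b : A) (hb : b ∈ LinearMap.ker ω.gnsClass) :
    a * b ∈ LinearMap.ker ω.gnsClass := by
  rw [LinearMap.mem_ker] at hb ⊢
  rw [← inner_self_eq_zero (𝕜 := ℂ), gnsClass_inner,
    show star (a * b) * (a * b) = star (star a * (a * b)) * b by simp [mul_assoc],
    ← gnsClass_inner, hb, inner_zero_right]

/-- `[b] ↦ [a b]`. -/
def gnsEnd (a : A) : Module.End ℂ (LinearMap.range ω.gnsClass) :=
  (ω.gnsClass.quotKerEquivRange).conj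
    ((LinearMap.ker ω.gnsClass).mapQ (LinearMap.ker ω.gnsClass) (LinearMap.mulLeft ℂ a)
      (fun b hb => ω.mul_mem_ker a b hb))

theorem gnsEnd_apply (a b : A) :
    ω.gnsEnd a (ω.gnsClass.rangeRestrict b) = ω.gnsClass.rangeRestrict (a * b) := by
  have h : ∀ c, ω.gnsClass.rangeRestrict c =
      ω.gnsClass.quotKerEquivRange (Submodule.Quotient.mk c) := fun c => Subtype.ext rfl
  rw [h, h, gnsEnd, LinearEquiv.conj_apply_apply, LinearEquiv.symm_apply_apply]
  rfl

/-- The GNS quadruple given by the GNS construction. -/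
def gnsQuadruple : GNSQuadruple ω ω.GNSSpace where
  D := LinearMap.range ω.gnsClass
  dense_D := by
    have : (LinearMap.range ω.gnsClass : Set ω.GNSSpace) =
        Set.range ((↑) : ω.PreGNS → ω.GNSSpace) := by
      ext x; exact Iff.rfl
    rw [this]
    exact UniformSpace.Completion.denseRange_coe
  π := AlgHom.ofLinearMap
    { toFun := ω.gnsEnd
      map_add' := fun a b => by
        ext ⟨_, c, rfl⟩ : 1
        change ω.gnsEnd (a + b) (ω.gnsClass.rangeRestrict c) =
          ω.gnsEnd a (ω.gnsClass.rangeRestrict c) + ω.gnsEnd b (ω.gnsClass.rangeRestrict c)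
        simp only [gnsEnd_apply, add_mul, map_add]
      map_smul' := fun r a => by
        ext ⟨_, c, rfl⟩ : 1
        change ω.gnsEnd (r • a) (ω.gnsClass.rangeRestrict c) =
          r • ω.gnsEnd a (ω.gnsClass.rangeRestrict c)
        simp only [gnsEnd_apply, smul_mul_assoc, map_smul] }
    (by
      ext ⟨_, c, rfl⟩ : 1
      change ω.gnsEnd 1 (ω.gnsClass.rangeRestrict c) = ω.gnsClass.rangeRestrict c
      rw [gnsEnd_apply, one_mul])
    (fun a b => by
      ext ⟨_, c, rfl⟩ : 1
      change ω.gnsEnd (a * b) (ω.gnsClass.rangeRestrict c) =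
        ω.gnsEnd a (ω.gnsEnd b (ω.gnsClass.rangeRestrict c))
      simp only [gnsEnd_apply, mul_assoc])
  star_le_adjoint := fun a => by
    refine LinearPMap.IsFormalAdjoint.le_adjoint ?_ ?_
    · change Dense (Set.range ((↑) : ω.PreGNS → ω.GNSSpace))
      exact UniformSpace.Completion.denseRange_coe
    · rintro ⟨_, b, rfl⟩ ⟨_, c, rfl⟩
      change ⟪(ω.gnsEnd a (ω.gnsClass.rangeRestrict b) : ω.GNSSpace), ω.gnsClass c⟫_ℂ =
        ⟪ω.gnsClass b, (ω.gnsEnd (star a) (ω.gnsClass.rangeRestrict c) : ω.GNSSpace)⟫_ℂ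
      rw [gnsEnd_apply, gnsEnd_apply]
      change ⟪ω.gnsClass (a * b), ω.gnsClass c⟫_ℂ = ⟪ω.gnsClass b, ω.gnsClass (star a * c)⟫_ℂ
      simp [gnsClass_inner, mul_assoc]
  ψ := ω.gnsClass.rangeRestrict 1
  cyclic := by
    rintro ⟨_, b, rfl⟩
    refine ⟨b, ?_⟩
    change ω.gnsEnd b (ω.gnsClass.rangeRestrict 1) = ω.gnsClass.rangeRestrict b
    rw [gnsEnd_apply, mul_one]
  expectation := fun a => by
    change ω a = ⟪ω.gnsClass 1, (ω.gnsEnd a (ω.gnsClass.rangeRestrict 1) : ω.GNSSpace)⟫_ℂ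
    rw [gnsEnd_apply]
    change ω a = ⟪ω.gnsClass 1, ω.gnsClass (a * 1)⟫_ℂ
    simp [gnsClass_inner]

end NonNormalizedState

end

/-! Part (a) rests on the spectral theorem for the selfadjoint closure `T` of `π (a)`. The resolvent
`R = (T + i)⁻¹` is bounded and normal, so the continuous functional calculus is a `*`-homomorphism
`Φ` from `C(σ(R), ℂ)` to bounded operators. Riesz-Markov represents `f ↦ ⟨x | Φ(f) x⟩` by a measure
`μ_x`, and `f ↦ Φ(f) x` is isometric for the norm of `L²(μ_x)`; extending it to indicators of Borel
sets gives projections. The map `w ↦ re (1/w)` inverts `λ ↦ 1/(λ + i)`, and pushing forward along it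
gives a projection-valued measure on `ℝ` for `T` (`exists_isSpectralMeasureOf`).

The moments have to be found for every spectral measure `P`, of which only the domain condition and
the quadratic form are given. These imply that `P(E)` commutes with `T` (`apply_proj`) and that `‖T
x‖² = ∫ t² dμ_x` (`norm_apply_sq`), whence `μ_{T x} = t² μ_x`. Iterating along `ψ, T ψ, T² ψ, …`,
which stays in `D`, makes `t^(2n) μ_ψ` a finite measure. Even moments are then `‖T^k ψ‖²` and odd
ones `⟨T^k ψ | T^(k+1) ψ⟩`, which are the values of `ω` on powers of `a`.

In part (b), positivity of `‖a‖² - a* a` bounds `π (a)` by `‖a‖`, and a bounded symmetric operator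
is essentially selfadjoint. The bound `|ω (a^(2n))| ≤ ‖ψ‖² ‖a‖^(2n)` confines every solution to one
compact interval, where Weierstrass approximation shows that moments determine the measure. -/

/-! ### Spectral projections of a `*`-homomorphism from `C(X, ℂ)` -/

section StarHom

open Filter Topology

variable {H : Type v} [NormedAddCommGroup H] [InnerProductSpace ℂ H] [CompleteSpace H]

/-- A bounded operator `P` with `⟨x | P x⟩ = ‖P x‖²` for all `x` is an orthogonal projection. -/
theorem isStarProjection_of_inner_eq_norm_sq (P : H →L[ℂ] H)
    (h : ∀ x, ⟪x, P x⟫_ℂ = ((‖P x‖ ^ 2 : ℝ) : ℂ)) : IsStarProjection P := by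
  -- Over `ℂ` the quadratic form determines the operator. Once `P = P* P`, `P` is selfadjoint, and
  -- the same equation reads `P² = P`.
  have key : star P * P = P := by
    apply ContinuousLinearMap.coe_injective
    rw [← ext_inner_map]
    intro x
    have h1 : ⟪P x, x⟫_ℂ = ((‖P x‖ ^ 2 : ℝ) : ℂ) := by
      rw [← inner_conj_symm, h, Complex.conj_ofReal]
    change ⟪ContinuousLinearMap.adjoint P (P x), x⟫_ℂ = ⟪P x, x⟫_ℂ
    rw [ContinuousLinearMap.adjoint_inner_left, h1, inner_self_eq_norm_sq_to_K]
    push_cast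
    rfl
  have hsa : IsSelfAdjoint P := by
    rw [← key]
    exact IsSelfAdjoint.star_mul_self P
  refine ⟨?_, hsa⟩
  rw [hsa.star_eq] at key
  exact key

variable {X : Type*} [MetricSpace X]

/-- A real-valued continuous function regarded as a complex-valued one. -/
noncomputable def ContinuousMap.toComplex (g : C(X, ℝ)) : C(X, ℂ) :=
  ⟨fun t => (g t : ℂ), by fun_prop⟩

@[simp] theorem ContinuousMap.toComplex_apply (g : C(X, ℝ)) (t : X) : g.toComplex t = (g t : ℂ) :=
  rfl

theorem StarAlgHom.norm_sq_apply (Φ : C(X, ℂ) →⋆ₐ[ℂ] (H →L[ℂ] H)) (f : C(X, ℂ)) (x : H) :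
    ⟪x, Φ (star f * f) x⟫_ℂ = ((‖Φ f x‖ ^ 2 : ℝ) : ℂ) := by
  rw [map_mul, map_star]
  change ⟪x, ContinuousLinearMap.adjoint (Φ f) (Φ f x)⟫_ℂ = _
  rw [ContinuousLinearMap.adjoint_inner_right, inner_self_eq_norm_sq_to_K]
  push_cast
  rfl

theorem StarAlgHom.inner_toComplex (Φ : C(X, ℂ) →⋆ₐ[ℂ] (H →L[ℂ] H)) (g : C(X, ℝ)) (x : H) :
    ⟪x, Φ g.toComplex x⟫_ℂ = ((⟪x, Φ g.toComplex x⟫_ℂ).re : ℂ) := by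
  have hs : star g.toComplex = g.toComplex := by
    ext t
    simp
  have : ContinuousLinearMap.adjoint (Φ g.toComplex) = Φ g.toComplex := by
    rw [← ContinuousLinearMap.star_eq_adjoint, ← map_star, hs]
  rw [eq_comm, ← Complex.conj_eq_iff_re, inner_conj_symm]
  conv_rhs => rw [← this]
  rw [ContinuousLinearMap.adjoint_inner_right]

variable [CompactSpace X] [MeasurableSpace X] [BorelSpace X]

/-- The positive functional `g ↦ ⟨x | Φ (g) x⟩`. -/
noncomputable def vectorFunctional (Φ : C(X, ℂ) →⋆ₐ[ℂ] (H →L[ℂ] H)) (x : H) :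
    CompactlySupportedContinuousMap X ℝ →ₚ[ℝ] ℝ :=
  PositiveLinearMap.mk₀
    { toFun := fun g => (⟪x, Φ (g : C(X, ℝ)).toComplex x⟫_ℂ).re
      map_add' := fun g g' => by
        have : (((g + g' : CompactlySupportedContinuousMap X ℝ) : C(X, ℝ))).toComplex =
            (g : C(X, ℝ)).toComplex + (g' : C(X, ℝ)).toComplex := by
          ext t; simp
        rw [this, map_add, add_apply, inner_add_right, Complex.add_re]
      map_smul' := fun c g => by
        have : (((c • g : CompactlySupportedContinuousMap X ℝ) : C(X, ℝ))).toComplex =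
            (c : ℂ) • (g : C(X, ℝ)).toComplex := by
          ext t; simp
        rw [this, map_smul, smul_apply, inner_smul_right, Complex.re_ofReal_mul]
        rfl }
    (by
      intro g hg
      let s : C(X, ℝ) := ⟨fun t => √(g t), by fun_prop⟩
      have : (g : C(X, ℝ)).toComplex = star s.toComplex * s.toComplex := by
        ext t
        have := Real.mul_self_sqrt (hg t)
        simp [s, ← Complex.ofReal_mul, this]
      change 0 ≤ (⟪x, Φ (g : C(X, ℝ)).toComplex x⟫_ℂ).re
      rw [this, Φ.norm_sq_apply, Complex.ofReal_re]
      positivity)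

/-- The measure `μ` on `X` with `⟨x | Φ (f) x⟩ = ∫ f dμ`. -/
noncomputable def vectorMeasure (Φ : C(X, ℂ) →⋆ₐ[ℂ] (H →L[ℂ] H)) (x : H) : Measure X :=
  RealRMK.rieszMeasure (vectorFunctional Φ x)

variable (Φ : C(X, ℂ) →⋆ₐ[ℂ] (H →L[ℂ] H))

instance (x : H) : IsFiniteMeasure (vectorMeasure Φ x) :=
  inferInstanceAs (IsFiniteMeasure (RealRMK.rieszMeasure _))

theorem integrable_continuousMap {E : Type*} [NormedAddCommGroup E]
    (μ : Measure X) [IsFiniteMeasure μ] (f : C(X, E)) : Integrable f μ :=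
  (map_continuous f).integrable_of_hasCompactSupport (HasCompactSupport.of_compactSpace f)

theorem integral_vectorMeasure_real (x : H) (g : C(X, ℝ)) :
    ⟪x, Φ g.toComplex x⟫_ℂ = ((∫ t, g t ∂(vectorMeasure Φ x) : ℝ) : ℂ) := by
  rw [Φ.inner_toComplex]
  congr 1
  exact (RealRMK.integral_rieszMeasure (vectorFunctional Φ x)
    (CompactlySupportedContinuousMap.continuousMapEquiv g)).symm

theorem integral_vectorMeasure (x : H) (f : C(X, ℂ)) :
    ⟪x, Φ f x⟫_ℂ = ∫ t, f t ∂(vectorMeasure Φ x) := by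
  let r : C(X, ℝ) := ⟨fun t => (f t).re, by fun_prop⟩
  let i : C(X, ℝ) := ⟨fun t => (f t).im, by fun_prop⟩
  have hf : f = r.toComplex + Complex.I • i.toComplex := by
    ext t
    simp [r, i, mul_comm Complex.I]
  conv_lhs => rw [hf]
  rw [map_add, map_smul, add_apply, smul_apply, inner_add_right, inner_smul_right,
    integral_vectorMeasure_real, integral_vectorMeasure_real, mul_comm]
  exact integral_re_add_im (integrable_continuousMap _ f)

theorem norm_sq_eq_integral (x : H) (f : C(X, ℂ)) :
    ‖Φ f x‖ ^ 2 = ∫ t, ‖f t‖ ^ 2 ∂(vectorMeasure Φ x) := by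
  have h := Φ.norm_sq_apply f x
  rw [integral_vectorMeasure] at h
  apply Complex.ofReal_injective
  rw [← h, ← integral_complex_ofReal]
  congr with t
  simp [Complex.conj_mul']

theorem measureReal_univ_vectorMeasure (x : H) : (vectorMeasure Φ x).real Set.univ = ‖x‖ ^ 2 := by
  have := norm_sq_eq_integral Φ x 1
  simpa using this.symm

/-- This isometry extends by density and completeness from continuous functions to all of `L²`, in
particular to indicators. -/
theorem norm_eq_toLp (x : H) (f : C(X, ℂ)) :
    ‖Φ f x‖ = ‖ContinuousMap.toLp 2 (vectorMeasure Φ x) ℂ f‖ := by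
  rw [← sq_eq_sq₀ (norm_nonneg _) (norm_nonneg _), norm_sq_eq_integral]
  have := L2.inner_def (𝕜 := ℂ) (ContinuousMap.toLp 2 (vectorMeasure Φ x) ℂ f)
    (ContinuousMap.toLp 2 (vectorMeasure Φ x) ℂ f)
  rw [inner_self_eq_norm_sq_to_K] at this
  apply Complex.ofReal_injective
  rw [Complex.ofReal_pow]
  refine Eq.trans ?_ this.symm
  rw [← integral_complex_ofReal]
  refine integral_congr_ae ?_
  filter_upwards [ContinuousMap.coeFn_toLp (p := 2) (𝕜 := ℂ) (vectorMeasure Φ x) f] with t ht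
  rw [ht, inner_self_eq_norm_sq_to_K]
  push_cast
  rfl

/-- Every `L²` function of the vector measure of `x` is realized by a vector. -/
theorem exists_vector_of_Lp (x : H) (g : Lp ℂ 2 (vectorMeasure Φ x)) :
    ∃ y : H, ∀ f : C(X, ℂ), ‖Φ f x - y‖ = ‖ContinuousMap.toLp 2 (vectorMeasure Φ x) ℂ f - g‖ := by
  set J := ContinuousMap.toLp (E := ℂ) 2 (vectorMeasure Φ x) ℂ with hJ
  have hd : DenseRange J := ContinuousMap.toLp_denseRange ℂ _ ℂ (by simp)
  obtain ⟨u, hu, hlim⟩ := mem_closure_iff_seq_limit.1 (hd g)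
  choose F hF using hu
  have hdist : ∀ f f' : C(X, ℂ), ‖Φ f x - Φ f' x‖ = ‖J f - J f'‖ := fun f f' => by
    rw [← map_sub, ← norm_eq_toLp, map_sub, sub_apply]
  have hc : CauchySeq fun n => Φ (F n) x := by
    have := hlim.cauchySeq
    rw [Metric.cauchySeq_iff] at this ⊢
    intro ε hε
    obtain ⟨N, hN⟩ := this ε hε
    refine ⟨N, fun m hm n hn => ?_⟩
    have := hN m hm n hn
    rwa [← hF, ← hF, dist_eq_norm, ← hdist, ← dist_eq_norm] at this
  obtain ⟨y, hy⟩ := cauchySeq_tendsto_of_complete hc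
  refine ⟨y, fun f => ?_⟩
  have h1 := (tendsto_const_nhds (x := Φ f x)).sub hy |>.norm
  have h2 := (tendsto_const_nhds (x := J f)).sub hlim |>.norm
  refine tendsto_nhds_unique h1 (h2.congr fun n => ?_)
  rw [← hF, hdist]

/-- The vector `y` plays the role of `Φ(1_E) x`. Its distances to all `Φ(f) x` determine it, since
continuous functions approximate `1_E` in `L²`. -/
theorem exists_spectralVector {E : Set X} (hE : MeasurableSet E) (x : H) :
    ∃ y : H, ∀ f : C(X, ℂ),
      ‖Φ f x - y‖ₑ = eLpNorm (E.indicator 1 - ⇑f) 2 (vectorMeasure Φ x) := by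
  obtain ⟨y, hy⟩ := exists_vector_of_Lp Φ x
    (indicatorConstLp 2 hE (measure_ne_top (vectorMeasure Φ x) E) (1 : ℂ))
  refine ⟨y, fun f => ?_⟩
  rw [← ofReal_norm, hy, ofReal_norm, Lp.enorm_def, eLpNorm_sub_comm]
  refine eLpNorm_congr_ae ?_
  filter_upwards [ContinuousMap.coeFn_toLp (p := 2) (𝕜 := ℂ) (vectorMeasure Φ x) f,
    indicatorConstLp_coeFn (p := 2) (hs := hE) (hμs := measure_ne_top (vectorMeasure Φ x) E)
      (c := (1 : ℂ)), Lp.coeFn_sub (ContinuousMap.toLp 2 (vectorMeasure Φ x) ℂ f)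
        (indicatorConstLp 2 hE (measure_ne_top (vectorMeasure Φ x) E) (1 : ℂ))] with t h1 h2 h3
  rw [h3, Pi.sub_apply, Pi.sub_apply, h1, h2]
  rfl

/-- The vector `P (E) x` of the projection-valued measure of `Φ`. -/
noncomputable def spectralVector {E : Set X} (hE : MeasurableSet E) (x : H) : H :=
  (exists_spectralVector Φ hE x).choose

theorem spectralVector_spec {E : Set X} (hE : MeasurableSet E) (x : H) (f : C(X, ℂ)) :
    ‖Φ f x - spectralVector Φ hE x‖ₑ = eLpNorm (E.indicator 1 - ⇑f) 2 (vectorMeasure Φ x) :=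
  (exists_spectralVector Φ hE x).choose_spec f

/-- A single continuous `f` must approximate `1_E` for three vectors at once. It is chosen in `L²`
of the sum of their three measures, which dominates each of them; linearity of `Φ(f)` then passes to
the limit. -/
theorem spectralVector_smul_add {E : Set X} (hE : MeasurableSet E) (c : ℂ) (x y : H) :
    spectralVector Φ hE (c • x + y) = c • spectralVector Φ hE x + spectralVector Φ hE y := by
  rw [← sub_eq_zero, ← enorm_eq_zero]
  set ν := vectorMeasure Φ (c • x + y) + (vectorMeasure Φ x + vectorMeasure Φ y) with hν
  have hm : MemLp (E.indicator (1 : X → ℂ)) 2 ν :=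
    MemLp.indicator hE (memLp_const (1 : ℂ))
  refine le_antisymm (ENNReal.le_of_forall_pos_le_add fun ε hε _ => ?_) bot_le
  -- `K` is the sum of the coefficients of the three approximation errors.
  set K : ENNReal := 1 + (‖c‖ₑ + 1) with hK
  have hK0 : K ≠ 0 := by simp [hK]
  have hKt : K ≠ ⊤ := by simp [hK]
  obtain ⟨g, hg, -⟩ := hm.exists_boundedContinuous_eLpNorm_sub_le (by simp)
    (ε := ε / K) (ENNReal.div_pos (by exact_mod_cast hε.ne') hKt).ne'
  let f : C(X, ℂ) := g.toContinuousMap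
  have hle : ∀ w : H, vectorMeasure Φ w ≤ ν →
      ‖Φ f w - spectralVector Φ hE w‖ₑ ≤ ε / K := fun w hw => by
    rw [spectralVector_spec]
    exact (eLpNorm_mono_measure _ hw).trans hg
  have h1 := hle (c • x + y) (Measure.le_add_right le_rfl)
  have h2 := hle x (Measure.le_add_left (Measure.le_add_right le_rfl))
  have h3 := hle y (Measure.le_add_left (Measure.le_add_left le_rfl))
  have heq : spectralVector Φ hE (c • x + y) -
      (c • spectralVector Φ hE x + spectralVector Φ hE y) =
      -(Φ f (c • x + y) - spectralVector Φ hE (c • x + y)) +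
        (c • (Φ f x - spectralVector Φ hE x) + (Φ f y - spectralVector Φ hE y)) := by
    rw [map_add, map_smul]
    module
  rw [heq, zero_add]
  calc _ ≤ ε / K + (‖c‖ₑ * (ε / K) + ε / K) := by
        refine (enorm_add_le _ _).trans (add_le_add (by rwa [enorm_neg]) ?_)
        refine (enorm_add_le _ _).trans (add_le_add ?_ h3)
        rw [enorm_smul]
        gcongr
    _ = K * (ε / K) := by rw [hK]; ring
    _ ≤ ε := ENNReal.mul_div_le

/-- This is the distance formula at the constant function `c`. The values `c = 0, 1, i` yield the
norm of the spectral vector and, by polarization, its inner product with `x`. -/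
theorem norm_smul_sub_spectralVector_sq {E : Set X} (hE : MeasurableSet E) (x : H) (c : ℂ) :
    ‖c • x - spectralVector Φ hE x‖ ^ 2 =
      (vectorMeasure Φ x).real E * ‖1 - c‖ ^ 2 +
        (‖x‖ ^ 2 - (vectorMeasure Φ x).real E) * ‖c‖ ^ 2 := by
  set μ := vectorMeasure Φ x with hμ
  have h := spectralVector_spec Φ hE x (algebraMap ℂ C(X, ℂ) c)
  rw [AlgHomClass.commutes] at h
  change ‖c • x - _‖ₑ = eLpNorm (fun t => E.indicator 1 t - c) 2 μ at h
  have hm : AEStronglyMeasurable (fun t => E.indicator (1 : X → ℂ) t - c) μ :=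
    ((stronglyMeasurable_one.indicator hE).sub stronglyMeasurable_const).aestronglyMeasurable
  have hint : ∫ t, ‖E.indicator (1 : X → ℂ) t - c‖ ^ 2 ∂μ =
      μ.real E * ‖1 - c‖ ^ 2 + (‖x‖ ^ 2 - μ.real E) * ‖c‖ ^ 2 := by
    rw [← measureReal_univ_vectorMeasure Φ x, ← hμ, ← measureReal_compl hE]
    have : (fun t => ‖E.indicator (1 : X → ℂ) t - c‖ ^ 2) = fun t =>
        E.indicator (fun _ => ‖1 - c‖ ^ 2) t + Eᶜ.indicator (fun _ => ‖c‖ ^ 2) t := by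
      ext t
      by_cases ht : t ∈ E <;> simp [ht]
    rw [this, integral_add ((integrable_const _).indicator hE)
      ((integrable_const _).indicator hE.compl), integral_indicator hE,
      integral_indicator hE.compl]
    simp
  rw [← hint, ← toReal_enorm, h, toReal_eLpNorm hm,
    lpNorm_eq_integral_norm_rpow_toReal (by simp) (by simp) hm, ← Real.rpow_natCast,
    ← Real.rpow_mul (integral_nonneg fun t => by positivity)]
  simp

theorem norm_spectralVector_sq {E : Set X} (hE : MeasurableSet E) (x : H) :
    ‖spectralVector Φ hE x‖ ^ 2 = (vectorMeasure Φ x).real E := by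
  simpa using norm_smul_sub_spectralVector_sq Φ hE x 0

theorem inner_spectralVector {E : Set X} (hE : MeasurableSet E) (x : H) :
    ⟪x, spectralVector Φ hE x⟫_ℂ = ((vectorMeasure Φ x).real E : ℂ) := by
  have h0 := norm_spectralVector_sq Φ hE x
  have h1 := norm_smul_sub_spectralVector_sq Φ hE x 1
  have h2 := norm_smul_sub_spectralVector_sq Φ hE x Complex.I
  have h3 : ‖(1 : ℂ) - Complex.I‖ ^ 2 = 2 := by
    rw [← Complex.normSq_eq_norm_sq]
    norm_num [Complex.normSq_apply]
  rw [@norm_sub_sq ℂ] at h1 h2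
  rw [h0, norm_smul, inner_smul_left] at h1 h2
  rw [h3] at h2
  simp at h1 h2
  apply Complex.ext
  · simp only [Complex.ofReal_re]; linarith
  · simp only [Complex.ofReal_im]; linarith

/-- The projection of the projection-valued measure of `Φ`. -/
theorem exists_spectralProjection {E : Set X} (hE : MeasurableSet E) :
    ∃ P : H →L[ℂ] H, IsStarProjection P ∧
      ∀ x, ⟪x, P x⟫_ℂ = ((vectorMeasure Φ x).real E : ℂ) := by
  have h0 : spectralVector Φ hE 0 = 0 := by
    have := norm_spectralVector_sq Φ hE 0
    have h' := measureReal_mono (μ := vectorMeasure Φ (0 : H)) (Set.subset_univ E)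
    rw [measureReal_univ_vectorMeasure] at h'
    simp only [norm_zero] at h'
    rw [← norm_eq_zero]
    nlinarith [norm_nonneg (spectralVector Φ hE 0)]
  let L : H →ₗ[ℂ] H :=
    { toFun := spectralVector Φ hE
      map_add' := fun x y => by simpa using spectralVector_smul_add Φ hE 1 x y
      map_smul' := fun c x => by simpa [h0] using spectralVector_smul_add Φ hE c x 0 }
  let P : H →L[ℂ] H := L.mkContinuous 1 fun x => by
    have := norm_spectralVector_sq Φ hE x
    have h' := measureReal_mono (μ := vectorMeasure Φ x) (Set.subset_univ E)
    rw [measureReal_univ_vectorMeasure, ← this] at h'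
    rw [one_mul]
    exact (sq_le_sq₀ (norm_nonneg _) (norm_nonneg _)).1 h'
  have hP : ∀ x, P x = spectralVector Φ hE x := fun x => rfl
  refine ⟨P, isStarProjection_of_inner_eq_norm_sq P fun x => ?_, fun x => ?_⟩
  · rw [hP, inner_spectralVector, norm_spectralVector_sq]
  · rw [hP, inner_spectralVector]

/-- The vector measure of `Φ (f) x` is `|f|²` times that of `x`. -/
theorem vectorMeasure_apply (x : H) (f : C(X, ℂ)) :
    vectorMeasure Φ (Φ f x) =
      (vectorMeasure Φ x).withDensity fun t => ENNReal.ofReal (‖f t‖ ^ 2) := by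
  have hf : IsFiniteMeasure
      ((vectorMeasure Φ x).withDensity fun t => ENNReal.ofReal (‖f t‖ ^ 2)) :=
    isFiniteMeasure_withDensity_ofReal
      (integrable_continuousMap _ (⟨fun t => ‖f t‖ ^ 2, by fun_prop⟩ : C(X, ℝ))).2
  refine ext_of_forall_integral_eq_of_IsFiniteMeasure fun g => ?_
  rw [integral_withDensity_eq_integral_toReal_smul (by fun_prop) (by simp)]
  apply Complex.ofReal_injective
  let g' : C(X, ℝ) := g.toContinuousMap
  have h := integral_vectorMeasure_real Φ (Φ f x) g'
  change _ = ((∫ t, g t ∂_ : ℝ) : ℂ) at h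
  have hmul : Φ (star f) (Φ g'.toComplex (Φ f x)) = Φ (star f * (g'.toComplex * f)) x := by
    rw [map_mul, map_mul]
    rfl
  rw [← h, ← ContinuousLinearMap.adjoint_inner_right, ← ContinuousLinearMap.star_eq_adjoint,
    ← map_star, hmul, integral_vectorMeasure, ← integral_complex_ofReal]
  congr with t
  have hg' : g' t = g t := rfl
  simp only [ContinuousMap.mul_apply, ContinuousMap.star_apply, ContinuousMap.toComplex_apply, hg',
    ENNReal.toReal_ofReal (sq_nonneg ‖f t‖), smul_eq_mul, Complex.ofReal_mul, Complex.ofReal_pow]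
  rw [← Complex.conj_mul', Complex.star_def]
  ring

end StarHom

/-! ### Projection-valued measures from families of measures -/

section OfMeasures

variable {H : Type v} [NormedAddCommGroup H] [InnerProductSpace ℂ H]

theorem ContinuousLinearMap.ext_inner_self {S T : H →L[ℂ] H}
    (h : ∀ x, ⟪x, S x⟫_ℂ = ⟪x, T x⟫_ℂ) : S = T := by
  apply ContinuousLinearMap.coe_injective
  rw [← ext_inner_map]
  intro x
  rw [← inner_conj_symm, ← inner_conj_symm (T.toLinearMap x)]
  exact congrArg _ (h x)

variable [CompleteSpace H]

theorem IsStarProjection.inner_apply_eq {P : H →L[ℂ] H} (hP : IsStarProjection P) (x y : H) :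
    ⟪P x, P y⟫_ℂ = ⟪x, P y⟫_ℂ := by
  have h1 : P (P y) = P y := congrArg (fun T : H →L[ℂ] H => T y) hP.isIdempotentElem
  have h2 : ContinuousLinearMap.adjoint P = P := hP.isSelfAdjoint
  rw [← ContinuousLinearMap.adjoint_inner_right, h2, h1]

theorem IsStarProjection.inner_self_apply {P : H →L[ℂ] H} (hP : IsStarProjection P) (x : H) :
    ⟪x, P x⟫_ℂ = ((‖P x‖ ^ 2 : ℝ) : ℂ) := by
  rw [← hP.inner_apply_eq, inner_self_eq_norm_sq_to_K]
  push_cast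
  rfl

/-- A family of finite measures whose values on each Borel set are the quadratic form of an
orthogonal projection comes from a projection-valued measure. -/
theorem PVM.exists_of_measures (μ : H → Measure ℝ) [∀ x, IsFiniteMeasure (μ x)]
    (huniv : ∀ x, (μ x).real Set.univ = ‖x‖ ^ 2)
    (hproj : ∀ E, MeasurableSet E → ∃ P : H →L[ℂ] H, IsStarProjection P ∧
      ∀ x, ⟪x, P x⟫_ℂ = ((μ x).real E : ℂ)) :
    ∃ P : PVM H, ∀ x, P.measure x = μ x := by
  classical
  choose! p hp hpμ using hproj
  have hnorm : ∀ E, MeasurableSet E → ∀ x, ‖p E x‖ ^ 2 = (μ x).real E := fun E hE x => by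
    have := (hp E hE).inner_self_apply x
    rw [hpμ E hE] at this
    exact_mod_cast this.symm
  -- Finite additivity of the operators is read off from that of the measures through quadratic
  -- forms.
  have hsum : ∀ (E : ℕ → Set ℝ), (∀ n, MeasurableSet (E n)) →
      Pairwise (Function.onFun Disjoint E) → ∀ s : Finset ℕ,
      p ((⋃ n, E n) \ ⋃ n ∈ s, E n) = p (⋃ n, E n) - ∑ n ∈ s, p (E n) := by
    intro E hE hd s
    have hs : MeasurableSet (⋃ n ∈ s, E n) := Finset.measurableSet_biUnion s fun n _ => hE n
    refine ContinuousLinearMap.ext_inner_self fun x => ?_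
    rw [hpμ _ ((MeasurableSet.iUnion hE).diff hs), sub_apply, inner_sub_right,
      hpμ _ (MeasurableSet.iUnion hE), sum_apply, inner_sum,
      Finset.sum_congr rfl fun n _ => hpμ _ (hE n) x, measureReal_sdiff
        (Set.iUnion₂_subset fun n _ => Set.subset_iUnion E n) hs,
      measureReal_biUnion_finset (fun i _ j _ hij => hd hij) fun n _ => hE n]
    push_cast
    rfl
  refine ⟨⟨p, hp, ?_, ?_⟩, fun x => ?_⟩
  · refine ContinuousLinearMap.ext_inner_self fun x => ?_
    change _ = ⟪x, x⟫_ℂ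
    rw [hpμ _ MeasurableSet.univ, huniv, inner_self_eq_norm_sq_to_K]
    push_cast
    rfl
  · intro E hE hd x
    have h1 : HasSum (fun n => (μ x).real (E n)) ((μ x).real (⋃ n, E n)) := by
      have := measure_iUnion hd hE (μ := μ x)
      rw [measureReal_def, this, ENNReal.tsum_toReal_eq fun n => measure_ne_top _ _]
      refine (ENNReal.summable_toReal ?_).hasSum
      rw [← this]
      exact measure_ne_top _ _
    -- The remainder is itself a projection applied to `x`, so its squared norm is the `μ x`-mass of
    -- the uncovered part of the union.
    have h2 : Filter.Tendsto (fun s : Finset ℕ => ‖p (⋃ n, E n) x - ∑ n ∈ s, p (E n) x‖ ^ 2)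
        Filter.atTop (nhds 0) := by
      have h3 := (tendsto_const_nhds (x := (μ x).real (⋃ n, E n))).sub h1
      rw [sub_self] at h3
      refine h3.congr fun s => ?_
      have hs : MeasurableSet (⋃ n ∈ s, E n) := Finset.measurableSet_biUnion s fun n _ => hE n
      have h4 := hnorm _ ((MeasurableSet.iUnion hE).diff hs) x
      rw [hsum E hE hd s, sub_apply, sum_apply, measureReal_sdiff
        (Set.iUnion₂_subset fun n _ => Set.subset_iUnion E n) hs,
        measureReal_biUnion_finset (fun i _ j _ hij => hd hij) fun n _ => hE n] at h4
      exact h4.symm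
    have h5 := h2.sqrt
    simp only [Real.sqrt_zero, Real.sqrt_sq (norm_nonneg _)] at h5
    have h6 := tendsto_zero_iff_norm_tendsto_zero.2 h5
    have h7 := (tendsto_const_nhds (x := p (⋃ n, E n) x)).sub h6
    rw [HasSum, SummationFilter.unconditional_filter]
    simpa using h7
  · ext E hE
    rw [PVM.measure_apply _ _ hE]
    change ENNReal.ofReal (⟪x, p E x⟫_ℂ).re = _
    rw [hpμ E hE, Complex.ofReal_re, ofReal_measureReal]

end OfMeasures

/-! ### The resolvent of a selfadjoint operator -/

section Resolvent

open Filter Topology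

variable {H : Type v} [NormedAddCommGroup H] [InnerProductSpace ℂ H] [CompleteSpace H]

theorem IsSelfAdjoint.inner_symm_apply {T : H →ₗ.[ℂ] H} (hT : IsSelfAdjoint T) (x y : T.domain) :
    ⟪T x, (y : H)⟫_ℂ = ⟪(x : H), T y⟫_ℂ := by
  have h := LinearPMap.adjoint_isFormalAdjoint hT.dense_domain
  rw [LinearPMap.isSelfAdjoint_def.1 hT] at h
  exact h x y

/-- A vector `y` with `⟨y | T x⟩ = ⟨w | x⟩` for all `x` lies in the domain of a selfadjoint `T`. -/
theorem IsSelfAdjoint.exists_apply_eq {T : H →ₗ.[ℂ] H} (hT : IsSelfAdjoint T) {y w : H}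
    (h : ∀ x : T.domain, ⟪w, (x : H)⟫_ℂ = ⟪y, T x⟫_ℂ) : ∃ hy : y ∈ T.domain, T ⟨y, hy⟩ = w := by
  have key : ∀ S : H →ₗ.[ℂ] H, S = T.adjoint → ∃ hy : y ∈ S.domain, S ⟨y, hy⟩ = w := by
    rintro S rfl
    have hy := LinearPMap.mem_adjoint_domain_of_exists (T := T) y ⟨w, h⟩
    exact ⟨hy, LinearPMap.adjoint_apply_eq hT.dense_domain ⟨y, hy⟩ h⟩
  exact key T (LinearPMap.isSelfAdjoint_def.1 hT).symm

/-- `⟨T x | x⟩` is real, so the cross term is purely imaginary. The resulting lower bound gives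
injectivity and closed range of `T + c i`. -/
theorem norm_sq_apply_add_smul {T : H →ₗ.[ℂ] H} (hT : IsSelfAdjoint T) (c : ℝ) (x : T.domain) :
    ‖T x + (c * Complex.I) • (x : H)‖ ^ 2 = ‖T x‖ ^ 2 + c ^ 2 * ‖(x : H)‖ ^ 2 := by
  have hreal : (⟪T x, (x : H)⟫_ℂ).im = 0 := by
    rw [← Complex.conj_eq_iff_im, inner_conj_symm, hT.inner_symm_apply]
  rw [@norm_add_sq ℂ, inner_smul_right, norm_smul]
  simp [hreal, mul_pow]

/-- The resolvent `(T + c i)⁻¹` of a selfadjoint operator. -/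
theorem exists_resolvent {T : H →ₗ.[ℂ] H} (hT : IsSelfAdjoint T) {c : ℝ} (hc : c ≠ 0) :
    ∃ R : H →L[ℂ] H, (∀ y, ∃ h : R y ∈ T.domain, T ⟨R y, h⟩ + (c * Complex.I) • R y = y) ∧
      ∀ x : T.domain, R (T x + (c * Complex.I) • (x : H)) = x := by
  let L : T.domain →ₗ[ℂ] H := T.toFun + (c * Complex.I) • T.domain.subtype
  have hL : ∀ x, L x = T x + (c * Complex.I) • (x : H) := fun x => rfl
  have hbound : ∀ x : T.domain, |c| * ‖(x : H)‖ ≤ ‖L x‖ := fun x => by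
    have := norm_sq_apply_add_smul hT c x
    rw [← hL] at this
    refine abs_le_of_sq_le_sq' ?_ (norm_nonneg _) |>.2
    rw [this, mul_pow, sq_abs]
    nlinarith [sq_nonneg ‖T x‖]
  have hc' : 0 < |c| := abs_pos.2 hc
  have hinj : Function.Injective L := by
    rw [← LinearMap.ker_eq_bot, LinearMap.ker_eq_bot']
    intro x hx
    have := hbound x
    rw [hx, norm_zero] at this
    have : ‖(x : H)‖ = 0 := by nlinarith [norm_nonneg (x : H)]
    exact Subtype.ext (norm_eq_zero.1 this)
  have hclosed : IsClosed (LinearMap.range L : Set H) := by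
    refine isClosed_of_closure_subset fun y hy => ?_
    obtain ⟨u, hu, hlim⟩ := mem_closure_iff_seq_limit.1 hy
    choose x hx using hu
    have hcs : CauchySeq fun n => (x n : H) := by
      have := hlim.cauchySeq
      rw [Metric.cauchySeq_iff] at this ⊢
      intro ε hε
      obtain ⟨N, hN⟩ := this (|c| * ε) (by positivity)
      refine ⟨N, fun m hm n hn => ?_⟩
      have h1 := hN m hm n hn
      rw [← hx, ← hx, dist_eq_norm, ← map_sub] at h1
      have h2 := hbound (x m - x n)
      rw [dist_eq_norm]
      exact lt_of_mul_lt_mul_left (h2.trans_lt h1) hc'.le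
    obtain ⟨z, hz⟩ := cauchySeq_tendsto_of_complete hcs
    have hT' : Tendsto (fun n => T (x n)) atTop (𝓝 (y - (c * Complex.I) • z)) := by
      refine (hlim.sub (hz.const_smul (c * Complex.I))).congr fun n => ?_
      rw [← hx, hL, add_sub_cancel_right]
    have hg : (z, y - (c * Complex.I) • z) ∈ T.graph :=
      hT.isClosed.mem_of_tendsto (hz.prodMk_nhds hT')
        (Eventually.of_forall fun n => T.mem_graph (x n))
    obtain ⟨w, hw1, hw2⟩ := (LinearPMap.mem_graph_iff _).1 hg
    refine ⟨w, ?_⟩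
    simp only at hw1 hw2
    rw [hL, hw1, hw2, sub_add_cancel]
  have hsurj : Function.Surjective L := by
    rw [← LinearMap.range_eq_top]
    have hco : IsComplete (LinearMap.range L : Set H) := hclosed.isComplete
    have : CompleteSpace (LinearMap.range L) := hco.completeSpace_coe
    -- A vector `v` orthogonal to the range lies in the domain of `T* = T` with `T v = c i v`. Then
    -- `(T + c i) v = 2 c i v` is orthogonal to `v`, so `v = 0`.
    rw [← Submodule.orthogonal_eq_bot_iff, Submodule.eq_bot_iff]
    intro v hv
    have hv' : ∀ x : T.domain, ⟪L x, v⟫_ℂ = 0 := fun x => hv _ ⟨x, rfl⟩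
    obtain ⟨hvd, hTv⟩ := hT.exists_apply_eq (y := v) (w := (c * Complex.I) • v) fun x => by
      have := congrArg (starRingEnd ℂ) (hv' x)
      rw [inner_conj_symm, map_zero, hL, inner_add_right, inner_smul_right] at this
      rw [inner_smul_left]
      simp only [map_mul, Complex.conj_ofReal, Complex.conj_I]
      linear_combination -this
    have h1 := hv' ⟨v, hvd⟩
    rw [hL, hTv, ← two_smul ℂ, inner_smul_left, inner_smul_left] at h1
    simpa [hc] using h1
  let e : T.domain ≃ₗ[ℂ] H := LinearEquiv.ofBijective L ⟨hinj, hsurj⟩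
  have he : ∀ x, e x = L x := fun x => rfl
  refine ⟨(T.domain.subtype ∘ₗ e.symm.toLinearMap).mkContinuous |c|⁻¹ fun y => ?_,
    fun y => ?_, fun x => ?_⟩
  · have := hbound (e.symm y)
    rw [← he, e.apply_symm_apply] at this
    rw [← div_eq_inv_mul, le_div_iff₀ hc', mul_comm]
    exact this
  · refine ⟨(e.symm y).2, ?_⟩
    have := e.apply_symm_apply y
    rwa [he, hL] at this
  · change ((e.symm (L x) : T.domain) : H) = x
    rw [← he, e.symm_apply_apply]

/-- The resolvent `R = (T + i)⁻¹` of a selfadjoint operator is normal, and `R* - R = 2i R* R`. -/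
theorem exists_normal_resolvent {T : H →ₗ.[ℂ] H} (hT : IsSelfAdjoint T) :
    ∃ R : H →L[ℂ] H, (∀ y, ∃ h : R y ∈ T.domain, T ⟨R y, h⟩ + Complex.I • R y = y) ∧
      (∀ x : T.domain, R (T x + Complex.I • (x : H)) = x) ∧ IsStarNormal R ∧
      star R - R = (2 * Complex.I) • (star R * R) := by
  -- Writing `x = (T + c i) R x` and `y = (T + c i) R y` in `⟨R x | y⟩ - ⟨x | R y⟩`, the terms with
  -- `T` cancel by symmetry.
  have hres : ∀ (R : H →L[ℂ] H) (c : ℝ),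
      (∀ y, ∃ h : R y ∈ T.domain, T ⟨R y, h⟩ + (c * Complex.I) • R y = y) →
      star R - R = (2 * c * Complex.I) • (star R * R) := by
    intro R c hR
    refine ContinuousLinearMap.ext fun y => ext_inner_left ℂ fun x => ?_
    obtain ⟨hx, hx'⟩ := hR x
    obtain ⟨hy, hy'⟩ := hR y
    have hs := hT.inner_symm_apply ⟨R x, hx⟩ ⟨R y, hy⟩
    have h1 : ⟪R x, y⟫_ℂ = ⟪R x, T ⟨R y, hy⟩⟫_ℂ + (c * Complex.I) * ⟪R x, R y⟫_ℂ := by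
      conv_lhs => rw [← hy', inner_add_right, inner_smul_right]
    have h2 : ⟪x, R y⟫_ℂ = ⟪T ⟨R x, hx⟩, R y⟫_ℂ - (c * Complex.I) * ⟪R x, R y⟫_ℂ := by
      conv_lhs => rw [← hx', inner_add_left, inner_smul_left]
      simp
      ring
    change ⟪x, ContinuousLinearMap.adjoint R y - R y⟫_ℂ =
      ⟪x, (2 * c * Complex.I) • ContinuousLinearMap.adjoint R (R y)⟫_ℂ
    rw [inner_sub_right, inner_smul_right, ContinuousLinearMap.adjoint_inner_right,
      ContinuousLinearMap.adjoint_inner_right, h1, h2, ← hs]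
    ring
  obtain ⟨R, hR1, hR2⟩ := exists_resolvent hT (c := 1) one_ne_zero
  obtain ⟨S, hS1, -⟩ := exists_resolvent hT (c := -1) (by norm_num)
  have hSR : star R = S := by
    refine ContinuousLinearMap.ext fun y => ext_inner_left ℂ fun x => ?_
    obtain ⟨hx, hx'⟩ := hR1 x
    obtain ⟨hy, hy'⟩ := hS1 y
    have hs := hT.inner_symm_apply ⟨R x, hx⟩ ⟨S y, hy⟩
    change ⟪x, ContinuousLinearMap.adjoint R y⟫_ℂ = _
    rw [ContinuousLinearMap.adjoint_inner_right]
    conv_lhs => rw [← hy', inner_add_right, inner_smul_right]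
    conv_rhs => rw [← hx', inner_add_left, inner_smul_left]
    rw [← hs]
    simp
  have h1 := hres R 1 hR1
  have h2 := hres S (-1) hS1
  rw [← hSR, star_star] at h2
  -- The identity for `R` at `c = 1` and for `R* = S` at `c = -1` have opposite left sides;
  -- comparing the right sides gives normality.
  have h3 : (2 * Complex.I) • (star R * R) = (2 * Complex.I) • (R * star R) := by
    have h1' : star R - R = (2 * Complex.I) • (star R * R) := by simpa using h1
    rw [← h1', ← neg_sub, h2, ← neg_smul]
    congr 1
    push_cast
    ring
  have h4 : star R * R = R * star R := by
    have h2I : (2 * Complex.I) ≠ 0 := by simp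
    exact smul_right_injective _ h2I h3
  refine ⟨R, by simpa using hR1, by simpa using hR2, ⟨h4⟩, by simpa using h1⟩

end Resolvent

/-! ### The spectral theorem for unbounded selfadjoint operators -/

section Existence

open Filter Topology

variable {H : Type v} [NormedAddCommGroup H] [InnerProductSpace ℂ H] [CompleteSpace H]
variable {X : Type*} [MetricSpace X] [CompactSpace X] [MeasurableSpace X] [BorelSpace X]

/-- The hypothesis is the scalar form of `R* - R = 2i R* R`. It describes the circle of all `1/(λ +
i)` with `λ` real, together with `0`. -/
theorem im_of_resolvent_circle {w : ℂ}
    (hw : (starRingEnd ℂ) w - w = 2 * Complex.I * ((starRingEnd ℂ) w * w)) :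
    w.im = -‖w‖ ^ 2 := by
  have h := congrArg Complex.im hw
  rw [Complex.conj_mul'] at h
  simp only [← Complex.ofReal_pow, Complex.sub_im, Complex.conj_im, Complex.mul_im, Complex.mul_re,
    Complex.I_re, Complex.I_im, Complex.re_ofNat, Complex.im_ofNat, Complex.ofReal_re,
    Complex.ofReal_im] at h
  linarith

theorem norm_inv_sq_of_resolvent_circle {w : ℂ} (hw : w.im = -‖w‖ ^ 2) (h0 : w ≠ 0) :
    ‖w⁻¹‖ ^ 2 = (w⁻¹).re ^ 2 + 1 := by
  have hn : ‖w‖ ^ 2 ≠ 0 := by simpa using h0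
  have : (w⁻¹).im = 1 := by
    rw [Complex.inv_im, hw, Complex.normSq_eq_norm_sq, neg_neg, div_self hn]
  rw [← Complex.normSq_eq_norm_sq, Complex.normSq_apply, this]
  ring

theorem norm_sq_mul_inv_re (w : ℂ) : ‖w‖ ^ 2 * (w⁻¹).re = w.re := by
  by_cases h0 : w = 0
  · simp [h0]
  have hn : ‖w‖ ^ 2 ≠ 0 := by simpa using h0
  rw [Complex.inv_re, Complex.normSq_eq_norm_sq]
  field_simp

theorem norm_sq_mul_inv_re_sq_le (w : ℂ) : ‖w‖ ^ 2 * (w⁻¹).re ^ 2 ≤ 1 := by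
  have h1 := Complex.abs_re_le_norm w⁻¹
  rw [norm_inv] at h1
  have h2 : ‖w‖ * |(w⁻¹).re| ≤ 1 :=
    (mul_le_mul_of_nonneg_left h1 (norm_nonneg w)).trans (mul_inv_le_one)
  rw [← sq_abs (w⁻¹).re, ← mul_pow]
  exact pow_le_one₀ (by positivity) h2

variable (Φ : C(X, ℂ) →⋆ₐ[ℂ] (H →L[ℂ] H))

/-- If `Φ (z)` has dense range, the set where `z` vanishes is a null set. -/
theorem vectorMeasure_zero_set (z : C(X, ℂ)) (hz : DenseRange (Φ z)) (x : H) :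
    vectorMeasure Φ x {t | z t = 0} = 0 := by
  have hE : MeasurableSet {t | z t = 0} := (isClosed_singleton.preimage z.continuous).measurableSet
  obtain ⟨P, hP, hPμ⟩ := exists_spectralProjection Φ hE
  -- The measure of `Φ(z) y` has density `|z|²`, which vanishes on the zero set. The projection thus
  -- kills a dense subspace.
  have h0 : ∀ y, P (Φ z y) = 0 := fun y => by
    have h1 := hP.inner_self_apply (Φ z y)
    have h2 : vectorMeasure Φ (Φ z y) {t | z t = 0} = 0 := by
      rw [vectorMeasure_apply, withDensity_apply _ hE, setLIntegral_eq_zero_iff hE (by fun_prop)]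
      exact Eventually.of_forall fun t ht => by simp [ht.out]
    rw [hPμ, measureReal_def, h2] at h1
    have h3 : ‖P (Φ z y)‖ ^ 2 = 0 := by exact_mod_cast h1.symm
    simpa using h3
  have h1 : ∀ x, P x = 0 := fun x =>
    congrFun (hz.equalizer P.continuous continuous_const (funext h0)) x
  have h2 := hPμ x
  rw [h1, inner_zero_right] at h2
  have h3 : (vectorMeasure Φ x).real {t | z t = 0} = 0 := by exact_mod_cast h2.symm
  exact (measureReal_eq_zero_iff).1 h3

/-- The density `|z|²` of the measure of `Φ(z) y` absorbs the singularity of `re (1/z)²`. -/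
theorem integrable_inv_re_sq_apply (z : C(X, ℂ)) (y : H) :
    Integrable (fun t => ((z t)⁻¹).re ^ 2) (vectorMeasure Φ (Φ z y)) := by
  rw [vectorMeasure_apply, integrable_withDensity_iff_integrable_smul' (by fun_prop) (by simp)]
  refine Integrable.of_bound (C := 1) (Measurable.aestronglyMeasurable ?_)
    (Eventually.of_forall fun t => ?_)
  · have := z.continuous.measurable
    fun_prop
  · rw [ENNReal.toReal_ofReal (sq_nonneg _), smul_eq_mul, Real.norm_of_nonneg (by positivity)]
    exact norm_sq_mul_inv_re_sq_le _

/-- For `Φ(z) = (T + i)⁻¹` the right side is `⟨x | T x⟩` with `x = Φ(z) y`. Both sides equal `∫ re z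
dμ_y`, because `conj z - i |z|² = re z` on the circle and `|z|² re (1/z) = re z`. -/
theorem integral_inv_re_apply (z : C(X, ℂ)) (hz : ∀ t, (z t).im = -‖z t‖ ^ 2) (y : H) :
    ((∫ t, ((z t)⁻¹).re ∂(vectorMeasure Φ (Φ z y)) : ℝ) : ℂ) =
      ⟪Φ z y, y - Complex.I • Φ z y⟫_ℂ := by
  have h1 : ⟪Φ z y, y⟫_ℂ = ∫ t, star (z t) ∂(vectorMeasure Φ y) := by
    rw [← ContinuousLinearMap.adjoint_inner_right, ← ContinuousLinearMap.star_eq_adjoint,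
      ← map_star, integral_vectorMeasure]
    rfl
  have h2 : ⟪Φ z y, Φ z y⟫_ℂ = ∫ t, ((‖z t‖ ^ 2 : ℝ) : ℂ) ∂(vectorMeasure Φ y) := by
    rw [integral_complex_ofReal, ← norm_sq_eq_integral, inner_self_eq_norm_sq_to_K]
    push_cast
    rfl
  rw [inner_sub_right, inner_smul_right, h1, h2, ← integral_const_mul, ← integral_sub,
    ← integral_complex_ofReal, vectorMeasure_apply,
    integral_withDensity_eq_integral_toReal_smul (by fun_prop) (by simp)]
  · congr with t
    rw [ENNReal.toReal_ofReal (sq_nonneg _), Complex.real_smul, ← Complex.ofReal_mul,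
      norm_sq_mul_inv_re]
    apply Complex.ext <;> simp [-Complex.ofReal_pow, hz t]
  · exact integrable_continuousMap _ (⟨fun t => star (z t), by fun_prop⟩ : C(X, ℂ))
  · exact integrable_continuousMap _
      (⟨fun t => Complex.I * ((‖z t‖ ^ 2 : ℝ) : ℂ), by fun_prop⟩ : C(X, ℂ))

/-- If `re (1/z)` is square integrable for the vector measure of `x`, then `x` is a limit of
vectors `Φ (z) yₙ` with `yₙ` bounded. -/
theorem exists_bounded_approx (z : C(X, ℂ)) (hz : ∀ t, (z t).im = -‖z t‖ ^ 2)
    (hd : DenseRange (Φ z)) (x : H)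
    (hx : Integrable (fun t => ((z t)⁻¹).re ^ 2) (vectorMeasure Φ x)) :
    ∃ (y : ℕ → H) (C : ℝ), (∀ n, ‖y n‖ ≤ C) ∧ Tendsto (fun n => Φ z (y n)) atTop (𝓝 x) := by
  set μ := vectorMeasure Φ x with hμ
  have hpos : ∀ n : ℕ, ∀ t, 0 < ‖z t‖ ^ 2 + 1 / ((n : ℝ) + 1) := fun n t => by positivity
  -- `g n` is a continuous regularization of `1/z`, with `|g n| ≤ 1/|z|` and `z g n → 1` off the
  -- null set `z = 0`. The bound `C` comes from `|1/z|² = re (1/z)² + 1`.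
  let g : ℕ → C(X, ℂ) := fun n =>
    ⟨fun t => star (z t) / ((‖z t‖ ^ 2 + 1 / ((n : ℝ) + 1) : ℝ) : ℂ), by
      refine Continuous.div (by fun_prop) (by fun_prop) fun t => ?_
      exact_mod_cast (hpos n t).ne'⟩
  have hg : ∀ n t, g n t = star (z t) / ((‖z t‖ ^ 2 + 1 / ((n : ℝ) + 1) : ℝ) : ℂ) :=
    fun n t => rfl
  have hne : ∀ᵐ t ∂μ, z t ≠ 0 := by
    rw [ae_iff]
    simpa using vectorMeasure_zero_set Φ z hd x
  have hgnorm : ∀ n t, ‖g n t‖ = ‖z t‖ / (‖z t‖ ^ 2 + 1 / ((n : ℝ) + 1)) := fun n t => by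
    rw [hg, norm_div, norm_star, Complex.norm_real, Real.norm_of_nonneg (hpos n t).le]
  have hzg : ∀ n t, z t * g n t =
      ((‖z t‖ ^ 2 / (‖z t‖ ^ 2 + 1 / ((n : ℝ) + 1)) : ℝ) : ℂ) := fun n t => by
    rw [hg, ← mul_div_assoc, Complex.star_def, Complex.mul_conj']
    push_cast
    rfl
  have hzg1 : ∀ n t, z t * g n t - 1 =
      ((-((1 / ((n : ℝ) + 1)) / (‖z t‖ ^ 2 + 1 / ((n : ℝ) + 1))) : ℝ) : ℂ) := fun n t => by
    rw [hzg, ← Complex.ofReal_one, ← Complex.ofReal_sub]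
    congr 1
    have := (hpos n t).ne'
    field_simp
    ring
  refine ⟨fun n => Φ (g n) x, √(∫ t, (((z t)⁻¹).re ^ 2 + 1) ∂μ), fun n => ?_, ?_⟩
  · refine Real.le_sqrt_of_sq_le ?_
    rw [norm_sq_eq_integral]
    refine integral_mono_ae (integrable_continuousMap _
      (⟨fun t => ‖g n t‖ ^ 2, by fun_prop⟩ : C(X, ℝ))) (hx.add (integrable_const _)) ?_
    filter_upwards [hne] with t ht
    rw [← norm_inv_sq_of_resolvent_circle (hz t) ht, hgnorm, norm_inv]
    have h0 : 0 < ‖z t‖ := norm_pos_iff.2 ht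
    gcongr
    rw [div_le_iff₀ (hpos n t), ← div_eq_inv_mul, le_div_iff₀ h0, ← sq]
    have : 0 < 1 / ((n : ℝ) + 1) := by positivity
    linarith
  · rw [tendsto_iff_norm_sub_tendsto_zero]
    have hnorm : ∀ n, ‖Φ z (Φ (g n) x) - x‖ ^ 2 = ∫ t, ‖z t * g n t - 1‖ ^ 2 ∂μ := fun n => by
      have : Φ z (Φ (g n) x) - x = Φ (z * g n - 1) x := by
        rw [map_sub, map_mul, map_one]
        rfl
      rw [this, norm_sq_eq_integral]
      rfl
    have hlim : Tendsto (fun n => ∫ t, ‖z t * g n t - 1‖ ^ 2 ∂μ) atTop (𝓝 (∫ t, (0 : ℝ) ∂μ)) := by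
      refine tendsto_integral_of_dominated_convergence (fun _ => 1) (fun n => ?_)
        (integrable_const _) (fun n => Eventually.of_forall fun t => ?_) ?_
      · exact Continuous.aestronglyMeasurable (by fun_prop)
      · rw [norm_pow, norm_norm]
        refine pow_le_one₀ (norm_nonneg _) ?_
        rw [hzg1, Complex.norm_real, norm_neg, Real.norm_of_nonneg
          (div_nonneg (by positivity) (hpos n t).le), div_le_one (hpos n t)]
        linarith [sq_nonneg ‖z t‖]
      · filter_upwards [hne] with t ht
        have h0 : ‖z t‖ ^ 2 ≠ 0 := by simpa using ht
        have h1 := tendsto_one_div_add_atTop_nhds_zero_nat (𝕜 := ℝ)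
        have h2 := ((h1.div (h1.const_add (‖z t‖ ^ 2)) (by simpa using h0)).neg).norm.pow 2
        simp only [zero_div, neg_zero, norm_zero, ne_eq, OfNat.ofNat_ne_zero, not_false_eq_true,
          zero_pow] at h2
        refine h2.congr fun n => ?_
        rw [hzg1, Complex.norm_real]
        rfl
    rw [integral_zero] at hlim
    have h5 := (hlim.congr fun n => (hnorm n).symm).sqrt
    simpa only [Real.sqrt_zero, Real.sqrt_sq (norm_nonneg _)] using h5

theorem norm_apply_star_eq (z : C(X, ℂ)) (w : H) : ‖Φ (star z) w‖ = ‖Φ z w‖ := by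
  rw [← sq_eq_sq₀ (norm_nonneg _) (norm_nonneg _), norm_sq_eq_integral, norm_sq_eq_integral]
  simp

/-- The spectral theorem: a selfadjoint operator has a spectral measure. -/
theorem exists_isSpectralMeasureOf {T : H →ₗ.[ℂ] H} (hT : IsSelfAdjoint T) :
    ∃ P : PVM H, P.IsSpectralMeasureOf T := by
  obtain ⟨R, hR1, hR2, hN, hRR⟩ := exists_normal_resolvent hT
  have : CompactSpace (spectrum ℂ R) := isCompact_iff_compactSpace.1 (spectrum.isCompact R)
  let Φ : C(spectrum ℂ R, ℂ) →⋆ₐ[ℂ] (H →L[ℂ] H) := cfcHom hN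
  let z : C(spectrum ℂ R, ℂ) := (ContinuousMap.id ℂ).restrict (spectrum ℂ R)
  have hΦz : Φ z = R := cfcHom_id hN
  have hz : ∀ t, (z t).im = -‖z t‖ ^ 2 := fun t => by
    have h1 : Φ (star z - z) = Φ ((2 * Complex.I) • (star z * z)) := by
      rw [map_sub, map_smul, map_mul, map_star, hΦz, hRR]
    have h2 := (cfcHom_isClosedEmbedding hN).injective h1
    have h3 := congrArg (fun f : C(spectrum ℂ R, ℂ) => f t) h2
    exact im_of_resolvent_circle (by simpa using h3)
  have hrange : ∀ x : T.domain, (x : H) = Φ z (T x + Complex.I • (x : H)) := fun x => by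
    rw [hΦz, hR2]
  have hd : DenseRange (Φ z) := by
    refine hT.dense_domain.mono fun x hx => ?_
    exact ⟨_, (hrange ⟨x, hx⟩).symm⟩
  -- `φ` recovers `λ` from `1/(λ + i)`. Its default value `0` at `z t = 0` is harmless, that set
  -- being null for every vector measure.
  let φ : spectrum ℂ R → ℝ := fun t => ((z t)⁻¹).re
  have hφ : Measurable φ := by
    have := z.continuous.measurable
    fun_prop
  obtain ⟨P, hP⟩ := PVM.exists_of_measures (fun x => (vectorMeasure Φ x).map φ)
    (fun x => by
      rw [measureReal_def, Measure.map_apply hφ MeasurableSet.univ, Set.preimage_univ]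
      exact measureReal_univ_vectorMeasure Φ x)
    (fun E hE => by
      obtain ⟨p, hp, hp'⟩ := exists_spectralProjection Φ (hφ hE)
      refine ⟨p, hp, fun x => ?_⟩
      rw [measureReal_def, Measure.map_apply hφ hE]
      exact hp' x)
  refine ⟨P, fun x => ?_, fun x => ?_⟩
  · rw [hP, integrable_map_measure (by fun_prop) hφ.aemeasurable]
    constructor
    · intro hx
      have h := integrable_inv_re_sq_apply Φ z
        (T ⟨x, hx⟩ + Complex.I • ((⟨x, hx⟩ : T.domain) : H))
      rwa [← hrange] at h
    · intro hx
      obtain ⟨y, C, hy, hlim⟩ := exists_bounded_approx Φ z hz hd x hx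
      rw [← LinearPMap.isSelfAdjoint_def.1 hT, LinearPMap.mem_adjoint_domain_iff]
      -- It suffices that `v ↦ ⟨x | T v⟩` is bounded, since `T* = T`. With `w = (T + i) v` and `x =
      -- lim R yₙ`, normality gives `|⟨R yₙ | w⟩| ≤ C ‖R* w‖ = C ‖R w‖ = C ‖v‖`.
      refine AddMonoidHomClass.continuous_of_bound _ (C + ‖x‖) fun v => ?_
      change ‖⟪x, T v⟫_ℂ‖ ≤ (C + ‖x‖) * ‖(v : H)‖
      set w := T v + Complex.I • (v : H) with hw
      have hv : (v : H) = Φ z w := hrange v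
      have h1 : ‖⟪x, w⟫_ℂ‖ ≤ C * ‖(v : H)‖ := by
        refine le_of_tendsto (hlim.inner tendsto_const_nhds).norm (Eventually.of_forall fun n => ?_)
        rw [← ContinuousLinearMap.adjoint_inner_right, ← ContinuousLinearMap.star_eq_adjoint,
          ← map_star]
        refine (norm_inner_le_norm _ _).trans ?_
        rw [norm_apply_star_eq, ← hv]
        exact mul_le_mul_of_nonneg_right (hy n) (norm_nonneg _)
      have h2 : T v = w - Complex.I • (v : H) := by rw [hw, add_sub_cancel_right]
      rw [h2, inner_sub_right, inner_smul_right, add_mul]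
      refine (norm_sub_le _ _).trans (add_le_add h1 ?_)
      rw [norm_mul, Complex.norm_I, one_mul]
      exact norm_inner_le_norm _ _
  · rw [hP, integral_map hφ.aemeasurable (by fun_prop)]
    have h := integral_inv_re_apply Φ z hz (T x + Complex.I • (x : H))
    rw [← hrange, add_sub_cancel_right] at h
    exact h.symm

end Existence

/-! ### Calculus of an arbitrary spectral measure -/

section PVMCalculus

open Filter Topology

variable {H : Type v} [NormedAddCommGroup H] [InnerProductSpace ℂ H] [CompleteSpace H]

namespace PVM

variable (P : PVM H)

instance (x : H) : IsFiniteMeasure (P.measure x) :=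
  ⟨by rw [P.measure_apply x MeasurableSet.univ]; exact ENNReal.ofReal_lt_top⟩

theorem norm_proj_sq {E : Set ℝ} (hE : MeasurableSet E) (x : H) :
    ‖P.proj E x‖ ^ 2 = (P.measure x).real E := by
  rw [measureReal_def, P.measure_apply x hE, P.inner_eq hE, Complex.ofReal_re,
    ENNReal.toReal_ofReal (sq_nonneg _)]

theorem measureReal_univ (x : H) : (P.measure x).real Set.univ = ‖x‖ ^ 2 := by
  rw [← P.norm_proj_sq MeasurableSet.univ, P.univ]
  rfl

theorem inner_proj {E : Set ℝ} (hE : MeasurableSet E) (x : H) :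
    ⟪x, P.proj E x⟫_ℂ = ((P.measure x).real E : ℂ) := by
  rw [P.inner_eq hE, P.norm_proj_sq hE]

theorem proj_union {E F : Set ℝ} (hE : MeasurableSet E) (hF : MeasurableSet F)
    (hd : Disjoint E F) (x : H) : P.proj (E ∪ F) x = P.proj E x + P.proj F x := by
  have : P.proj (E ∪ F) = P.proj E + P.proj F := by
    refine ContinuousLinearMap.ext_inner_self fun x => ?_
    rw [P.inner_proj (hE.union hF), add_apply, inner_add_right, P.inner_proj hE,
      P.inner_proj hF, measureReal_union hd hF]
    push_cast
    rfl
  rw [this, add_apply]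

theorem proj_proj_self {E : Set ℝ} (hE : MeasurableSet E) (x : H) :
    P.proj E (P.proj E x) = P.proj E x :=
  congrArg (fun T : H →L[ℂ] H => T x) (P.isProj E hE).isIdempotentElem

theorem inner_proj_left {E : Set ℝ} (hE : MeasurableSet E) (x y : H) :
    ⟪P.proj E x, y⟫_ℂ = ⟪x, P.proj E y⟫_ℂ := by
  have h : ContinuousLinearMap.adjoint (P.proj E) = P.proj E := (P.isProj E hE).isSelfAdjoint
  rw [← ContinuousLinearMap.adjoint_inner_right, h]

/-- The measure of `v = P(E) x` already has its full mass `‖v‖²` on `E`, which leaves none for `F`.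
-/
theorem proj_proj_of_disjoint {E F : Set ℝ} (hE : MeasurableSet E) (hF : MeasurableSet F)
    (hd : Disjoint E F) (x : H) : P.proj F (P.proj E x) = 0 := by
  have h1 := P.norm_proj_sq hE (P.proj E x)
  have h2 := P.norm_proj_sq hF (P.proj E x)
  have h3 := measureReal_mono (μ := P.measure (P.proj E x)) (Set.subset_univ (E ∪ F))
  rw [P.measureReal_univ, measureReal_union hd hF, ← h1, ← h2, P.proj_proj_self hE] at h3
  rw [← norm_eq_zero, ← sq_eq_zero_iff]
  exact le_antisymm (by linarith) (sq_nonneg _)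

theorem proj_proj {E F : Set ℝ} (hE : MeasurableSet E) (hF : MeasurableSet F) (x : H) :
    P.proj F (P.proj E x) = P.proj (F ∩ E) x := by
  have h1 := P.proj_union (hF.inter hE) (hF.diff hE) Set.disjoint_sdiff_inter.symm (P.proj E x)
  have h2 := P.proj_union (hE.inter hF) (hE.diff hF) Set.disjoint_sdiff_inter.symm x
  rw [Set.inter_union_sdiff] at h1 h2
  rw [h1, P.proj_proj_of_disjoint hE (hF.diff hE) Set.disjoint_sdiff_right, add_zero, h2, map_add,
    P.proj_proj_of_disjoint (hE.diff hF) (hF.inter hE)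
      (Set.disjoint_sdiff_left.mono_right Set.inter_subset_left), add_zero, Set.inter_comm E F,
    P.proj_proj_self (hF.inter hE)]

theorem proj_add_compl {E : Set ℝ} (hE : MeasurableSet E) (x : H) :
    P.proj E x + P.proj Eᶜ x = x := by
  rw [← P.proj_union hE hE.compl disjoint_compl_right, Set.union_compl_self, P.univ]
  rfl

theorem measure_eq_ofReal {E : Set ℝ} (hE : MeasurableSet E) (x : H) :
    P.measure x E = ENNReal.ofReal (‖P.proj E x‖ ^ 2) := by
  rw [P.norm_proj_sq hE, ofReal_measureReal]

theorem measure_proj {E : Set ℝ} (hE : MeasurableSet E) (x : H) :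
    P.measure (P.proj E x) = (P.measure x).restrict E := by
  ext F hF
  rw [Measure.restrict_apply hF, P.measure_eq_ofReal hF, P.proj_proj hE hF,
    P.measure_eq_ofReal (hF.inter hE)]

theorem inner_proj_proj_eq_zero {E F : Set ℝ} (hE : MeasurableSet E) (hF : MeasurableSet F)
    {x y : H} (hx : P.proj E x = x) (hy : P.proj Eᶜ y = y) :
    ⟪P.proj F x, P.proj F y⟫_ℂ = 0 := by
  rw [P.inner_proj_left hF, P.proj_proj_self hF, ← hx, P.inner_proj_left hE, ← hy,
    P.proj_proj hE.compl hF, P.proj_proj (hF.inter hE.compl) hE]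
  have : E ∩ (F ∩ Eᶜ) = ∅ := by
    ext t
    simp only [Set.mem_inter_iff, Set.mem_compl_iff, Set.mem_empty_iff_false, iff_false]
    tauto
  rw [this, P.empty, inner_zero_right]

theorem measure_add {E : Set ℝ} (hE : MeasurableSet E) {x y : H} (hx : P.proj E x = x)
    (hy : P.proj Eᶜ y = y) : P.measure (x + y) = P.measure x + P.measure y := by
  ext F hF
  rw [Measure.add_apply, P.measure_eq_ofReal hF, P.measure_eq_ofReal hF, P.measure_eq_ofReal hF,
    ← ENNReal.ofReal_add (sq_nonneg _) (sq_nonneg _), map_add, @norm_add_sq ℂ,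
    P.inner_proj_proj_eq_zero hE hF hx hy]
  simp

end PVM

theorem integrable_id_of_sq {μ : Measure ℝ} [IsFiniteMeasure μ]
    (h : Integrable (fun t : ℝ => t ^ 2) μ) : Integrable (fun t : ℝ => t) μ := by
  refine ((integrable_const (1 : ℝ)).add h).mono' (by fun_prop) (Eventually.of_forall fun t => ?_)
  rw [Real.norm_eq_abs, Pi.add_apply]
  nlinarith [sq_nonneg (|t| - 1), sq_abs t]

namespace PVM.IsSpectralMeasureOf

variable {P : PVM H} {T : H →ₗ.[ℂ] H}

theorem proj_mem (hP : P.IsSpectralMeasureOf T)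
    {E : Set ℝ} (hE : MeasurableSet E) {x : H} (hx : x ∈ T.domain) :
    P.proj E x ∈ T.domain := by
  rw [hP.mem_domain] at hx ⊢
  rw [P.measure_proj hE]
  exact hx.restrict

/-- The measure of `x + y` is the sum of the two measures, so the form `⟨x | T x⟩` is additive here
and its cross terms sum to zero. Replacing `y` by `i y` separates them. -/
theorem inner_eq_zero (hP : P.IsSpectralMeasureOf T)
    {E : Set ℝ} (hE : MeasurableSet E) (x y : T.domain)
    (hx : P.proj E x = (x : H)) (hy : P.proj Eᶜ y = (y : H)) : ⟪(x : H), T y⟫_ℂ = 0 := by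
  have key : ∀ y : T.domain, P.proj Eᶜ y = (y : H) →
      ⟪(x : H), T y⟫_ℂ + ⟪(y : H), T x⟫_ℂ = 0 := fun y hy => by
    have h1 := hP.inner_apply (x + y)
    rw [Submodule.coe_add, P.measure_add hE hx hy, integral_add_measure
      (integrable_id_of_sq ((hP.mem_domain x).1 x.2))
      (integrable_id_of_sq ((hP.mem_domain y).1 y.2)), Complex.ofReal_add, ← hP.inner_apply,
      ← hP.inner_apply, LinearPMap.map_add, inner_add_left, inner_add_right, inner_add_right] at h1
    linear_combination h1
  have h1 := key y hy
  have h2 := key (Complex.I • y) (by rw [Submodule.coe_smul, map_smul, hy])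
  rw [LinearPMap.map_smul, Submodule.coe_smul, inner_smul_right, inner_smul_left,
    Complex.conj_I] at h2
  linear_combination h1 / 2 - Complex.I / 2 * h2 +
    (⟪(x : H), T y⟫_ℂ - ⟪(y : H), T x⟫_ℂ) / 2 * Complex.I_mul_I

/-- By `inner_eq_zero`, `T` maps domain vectors in the range of `P(E)` into that range, and likewise
for `Eᶜ`; splitting `x` along the two ranges gives commutation. -/
theorem apply_proj (hP : P.IsSpectralMeasureOf T)
    (hd : Dense (T.domain : Set H)) {E : Set ℝ} (hE : MeasurableSet E)
    (x : T.domain) : T ⟨P.proj E x, hP.proj_mem hE x.2⟩ = P.proj E (T x) := by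
  have key : ∀ {E : Set ℝ}, MeasurableSet E → ∀ y : T.domain, P.proj Eᶜ y = (y : H) →
      P.proj E (T y) = 0 := fun {E} hE y hy => by
    refine hd.eq_zero_of_inner_right ℂ fun v hv => ?_
    rw [← P.inner_proj_left hE]
    exact hP.inner_eq_zero hE ⟨P.proj E v, hP.proj_mem hE hv⟩ y (P.proj_proj_self hE v) hy
  set x₁ : T.domain := ⟨P.proj E x, hP.proj_mem hE x.2⟩
  set x₂ : T.domain := ⟨P.proj Eᶜ x, hP.proj_mem hE.compl x.2⟩
  have hx : x = x₁ + x₂ := Subtype.ext (P.proj_add_compl hE x).symm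
  have h1 : P.proj Eᶜ (T x₁) = 0 := key hE.compl x₁ (by
    rw [compl_compl]
    exact P.proj_proj_self hE _)
  have h2 : P.proj E (T x₂) = 0 := key hE x₂ (P.proj_proj_self hE.compl _)
  rw [hx, LinearPMap.map_add, map_add, h2, add_zero]
  have := P.proj_add_compl hE (T x₁)
  rw [h1, add_zero] at this
  exact this.symm

theorem inner_proj_apply (hP : P.IsSpectralMeasureOf T)
    (hd : Dense (T.domain : Set H)) {F : Set ℝ} (hF : MeasurableSet F)
    (x : T.domain) :
    ⟪P.proj F x, P.proj F (T x)⟫_ℂ = ((∫ t in F, t ∂(P.measure (x : H)) : ℝ) : ℂ) := by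
  rw [← hP.apply_proj hd hF, ← P.measure_proj hF]
  exact hP.inner_apply ⟨P.proj F x, hP.proj_mem hF x.2⟩

theorem mem_domain_of_bounded (hP : P.IsSpectralMeasureOf T)
    {N : ℝ} {x : H} (hx : P.proj (Set.Icc (-N) N) x = x) :
    x ∈ T.domain := by
  rw [hP.mem_domain, ← hx, P.measure_proj measurableSet_Icc]
  exact (by fun_prop : Continuous fun t : ℝ => t ^ 2).continuousOn.integrableOn_compact
    isCompact_Icc

/-- With `u = T x`, again in the domain, polarization of the measures gives `μ_{x+u} - μ_{x-u} = 4 t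
μ_x`. Integrating `t` against both sides yields `4 ‖T x‖² = 4 ∫ t² dμ_x`. -/
theorem norm_apply_sq_of_bounded (hP : P.IsSpectralMeasureOf T) (hT : IsSymmetricOperator T)
    {N : ℝ} (hN : 0 ≤ N) (x : T.domain) (hx : P.proj (Set.Icc (-N) N) x = (x : H)) :
    ‖T x‖ ^ 2 = ∫ t, t ^ 2 ∂(P.measure (x : H)) := by
  have hd := hT.dense_domain
  have hI : MeasurableSet (Set.Icc (-N) N) := measurableSet_Icc
  have hu : P.proj (Set.Icc (-N) N) (T x) = T x := by
    rw [← hP.apply_proj hd hI]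
    congr 2
  let u : T.domain := ⟨T x, hP.mem_domain_of_bounded hu⟩
  have hsupp : ∀ᵐ t ∂(P.measure (x : H)), t ∈ Set.Icc (-N) N := by
    rw [← hx, P.measure_proj hI]
    exact ae_restrict_mem hI
  have hint : ∀ y : T.domain, Integrable (fun t : ℝ => t) (P.measure (y : H)) := fun y =>
    integrable_id_of_sq ((hP.mem_domain y).1 y.2)
  -- Adding `4 N μ_x` to both sides replaces the signed density `4 t` by `4 (t + N)`, nonnegative on
  -- `[-N, N]`, so that all terms are positive measures.
  have hmeas : P.measure ((x + u : T.domain) : H) + ENNReal.ofReal (4 * N) • P.measure (x : H) =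
      P.measure ((x - u : T.domain) : H) +
        (P.measure (x : H)).withDensity fun t => ENNReal.ofReal (4 * (t + N)) := by
    ext F hF
    have h1 : (P.measure (x : H)).withDensity (fun t => ENNReal.ofReal (4 * (t + N))) F =
        ENNReal.ofReal (∫ t in F, 4 * (t + N) ∂(P.measure (x : H))) := by
      rw [withDensity_apply _ hF, ofReal_integral_eq_lintegral_ofReal]
      · exact (((hint x).add (integrable_const N)).const_mul 4).restrict
      · refine ae_restrict_of_ae (hsupp.mono fun t ht => ?_)
        have := ht.1
        simp only [Pi.zero_apply]
        linarith
    have h1' : 0 ≤ ∫ t in F, 4 * (t + N) ∂(P.measure (x : H)) := by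
      refine integral_nonneg_of_ae (ae_restrict_of_ae (hsupp.mono fun t ht => ?_))
      have := ht.1
      simp only [Pi.zero_apply]
      linarith
    have h2 : ∫ t in F, 4 * (t + N) ∂(P.measure (x : H)) =
        4 * (∫ t in F, t ∂(P.measure (x : H))) + 4 * N * (P.measure (x : H)).real F := by
      rw [integral_const_mul, integral_add (hint x).restrict (integrable_const N)]
      simp
      ring
    have h3 := congrArg Complex.re (hP.inner_proj_apply hd hF x)
    rw [Complex.ofReal_re] at h3
    rw [Measure.add_apply, Measure.add_apply, Measure.smul_apply, smul_eq_mul, h1,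
      P.measure_eq_ofReal hF, P.measure_eq_ofReal hF, P.measure_eq_ofReal hF,
      ← ENNReal.ofReal_mul (by positivity), ← ENNReal.ofReal_add (by positivity) (by positivity),
      ← ENNReal.ofReal_add (by positivity) h1']
    congr 1
    rw [h2, ← h3, Submodule.coe_add, Submodule.coe_sub, map_add, map_sub, @norm_add_sq ℂ,
      @norm_sub_sq ℂ, ← P.norm_proj_sq hF]
    change _ + 2 * (⟪P.proj F x, P.proj F (T x)⟫_ℂ).re + _ + _ =
      _ - 2 * (⟪P.proj F x, P.proj F (T x)⟫_ℂ).re + _ + _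
    ring
  have hw : Integrable (fun t : ℝ => t)
      ((P.measure (x : H)).withDensity fun t => ENNReal.ofReal (4 * (t + N))) := by
    rw [integrable_withDensity_iff_integrable_smul' (by fun_prop)
      (ae_of_all _ fun _ => ENNReal.ofReal_lt_top)]
    refine Integrable.of_bound (C := 4 * (N + N) * N) (by fun_prop) (hsupp.mono fun t ht => ?_)
    obtain ⟨ht1, ht2⟩ := ht
    rw [ENNReal.toReal_ofReal (by linarith), smul_eq_mul, norm_mul, Real.norm_of_nonneg
      (by linarith), Real.norm_eq_abs]
    have : |t| ≤ N := abs_le.2 ⟨ht1, ht2⟩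
    gcongr
  have h1 := congrArg (fun μ => ∫ t : ℝ, t ∂μ) hmeas
  rw [integral_add_measure (hint _) ((hint _).smul_measure ENNReal.ofReal_ne_top),
    integral_add_measure (hint _) hw, integral_smul_measure,
    integral_withDensity_eq_integral_toReal_smul (by fun_prop)
      (ae_of_all _ fun _ => ENNReal.ofReal_lt_top),
    ENNReal.toReal_ofReal (by positivity)] at h1
  have h2 : ∫ t, (ENNReal.ofReal (4 * (t + N))).toReal • t ∂(P.measure (x : H)) =
      4 * (∫ t, t ^ 2 ∂(P.measure (x : H))) + 4 * N * ∫ t, t ∂(P.measure (x : H)) := by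
    rw [← integral_const_mul, ← integral_const_mul, ← integral_add
      (((hP.mem_domain x).1 x.2).const_mul 4) ((hint x).const_mul _)]
    refine integral_congr_ae (hsupp.mono fun t ht => ?_)
    have := ht.1
    simp only
    rw [ENNReal.toReal_ofReal (by linarith), smul_eq_mul]
    ring
  have h3 := hP.inner_apply (x + u)
  have h4 := hP.inner_apply (x - u)
  have hux : ⟪(x : H), T u⟫_ℂ = ((‖T x‖ ^ 2 : ℝ) : ℂ) := by
    rw [← hT.hermitian x u]
    change ⟪T x, T x⟫_ℂ = _
    rw [inner_self_eq_norm_sq_to_K]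
    push_cast
    rfl
  have hxu : ⟪(u : H), T x⟫_ℂ = ((‖T x‖ ^ 2 : ℝ) : ℂ) := by
    change ⟪T x, T x⟫_ℂ = _
    rw [inner_self_eq_norm_sq_to_K]
    push_cast
    rfl
  rw [LinearPMap.map_add, Submodule.coe_add, inner_add_left, inner_add_right, inner_add_right,
    hux, hxu] at h3
  rw [LinearPMap.map_sub, Submodule.coe_sub, inner_sub_left, inner_sub_right, inner_sub_right,
    hux, hxu] at h4
  have h5 : (∫ t, t ∂(P.measure ((x + u : T.domain) : H))) -
      (∫ t, t ∂(P.measure ((x - u : T.domain) : H))) = 4 * ‖T x‖ ^ 2 := by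
    apply Complex.ofReal_injective
    rw [Submodule.coe_add, Submodule.coe_sub, Complex.ofReal_sub, ← h3, ← h4]
    push_cast
    ring
  rw [h2, smul_eq_mul] at h1
  linarith

/-- The bounded case applies to `P([-n, n]) x`, and `P([-n, n])` commutes with `T`; then `n → ∞`. -/
theorem norm_apply_sq (hP : P.IsSpectralMeasureOf T) (hT : IsSymmetricOperator T) (x : T.domain) :
    ‖T x‖ ^ 2 = ∫ t, t ^ 2 ∂(P.measure (x : H)) := by
  have hd := hT.dense_domain
  have hmono : Monotone fun n : ℕ => Set.Icc (-(n : ℝ)) (n : ℝ) := fun m n hmn => by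
    have : (m : ℝ) ≤ n := by exact_mod_cast hmn
    exact Set.Icc_subset_Icc (by linarith) this
  have hunion : ⋃ n : ℕ, Set.Icc (-(n : ℝ)) (n : ℝ) = Set.univ := by
    refine Set.eq_univ_of_forall fun t => ?_
    obtain ⟨n, hn⟩ := exists_nat_ge |t|
    exact Set.mem_iUnion.2 ⟨n, abs_le.1 hn⟩
  have h1 : Tendsto (fun n : ℕ => (P.measure (T x)).real (Set.Icc (-(n : ℝ)) (n : ℝ))) atTop
      (𝓝 ((P.measure (T x)).real Set.univ)) := by
    rw [← hunion]
    exact (ENNReal.tendsto_toReal (measure_ne_top _ _)).comp (tendsto_measure_iUnion_atTop hmono)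
  have h2 : Tendsto (fun n : ℕ => ∫ t in Set.Icc (-(n : ℝ)) (n : ℝ), t ^ 2 ∂(P.measure (x : H)))
      atTop (𝓝 (∫ t in Set.univ, t ^ 2 ∂(P.measure (x : H)))) := by
    rw [← hunion]
    exact tendsto_setIntegral_of_monotone (fun n => measurableSet_Icc) hmono
      ((hP.mem_domain x).1 x.2).integrableOn
  rw [setIntegral_univ] at h2
  rw [P.measureReal_univ] at h1
  refine tendsto_nhds_unique h1 (h2.congr fun n => ?_)
  rw [← P.norm_proj_sq measurableSet_Icc, ← hP.apply_proj hd measurableSet_Icc,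
    hP.norm_apply_sq_of_bounded hT n.cast_nonneg _ (P.proj_proj_self measurableSet_Icc _),
    P.measure_proj measurableSet_Icc]

theorem measure_apply (hP : P.IsSpectralMeasureOf T) (hT : IsSymmetricOperator T) (x : T.domain) :
    P.measure (T x) = (P.measure (x : H)).withDensity fun t => ENNReal.ofReal (t ^ 2) := by
  ext F hF
  rw [withDensity_apply _ hF, P.measure_eq_ofReal hF, ← hP.apply_proj hT.dense_domain hF,
    hP.norm_apply_sq hT, P.measure_proj hF, ofReal_integral_eq_lintegral_ofReal
      ((hP.mem_domain x).1 x.2).restrict (Eventually.of_forall fun t => sq_nonneg t)]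

/-- The spectral measure of the orbit `x, T x, T² x, …`. -/
theorem measure_orbit (hP : P.IsSpectralMeasureOf T) (hT : IsSymmetricOperator T)
    (x : ℕ → T.domain)
    (hx : ∀ n, (x (n + 1) : H) = T (x n)) (n : ℕ) :
    P.measure (x n : H) =
      (P.measure (x 0 : H)).withDensity fun t => ENNReal.ofReal (t ^ (2 * n)) := by
  induction n with
  | zero => simp
  | succ n ih =>
    rw [hx, hP.measure_apply hT, ih, ← withDensity_mul _ (by fun_prop) (by fun_prop)]
    congr with t
    rw [Pi.mul_apply, ← ENNReal.ofReal_mul (by rw [pow_mul]; positivity)]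
    congr 1
    ring

theorem integrable_even_pow (hP : P.IsSpectralMeasureOf T) (hT : IsSymmetricOperator T)
    (x : ℕ → T.domain)
    (hx : ∀ n, (x (n + 1) : H) = T (x n)) (n : ℕ) :
    Integrable (fun t : ℝ => t ^ (2 * n)) (P.measure (x 0 : H)) := by
  have h : Integrable (fun _ : ℝ => (1 : ℝ)) (P.measure (x n : H)) := integrable_const _
  rw [hP.measure_orbit hT x hx, integrable_withDensity_iff_integrable_smul' (by fun_prop)
    (by simp)] at h
  refine h.congr (Eventually.of_forall fun t => ?_)
  simp only [smul_eq_mul, mul_one]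
  rw [ENNReal.toReal_ofReal (by rw [pow_mul]; positivity)]

theorem integrable_pow (hP : P.IsSpectralMeasureOf T) (hT : IsSymmetricOperator T)
    (x : ℕ → T.domain)
    (hx : ∀ n, (x (n + 1) : H) = T (x n)) (n : ℕ) :
    Integrable (fun t : ℝ => t ^ n) (P.measure (x 0 : H)) := by
  refine ((integrable_const (1 : ℝ)).add (hP.integrable_even_pow hT x hx n)).mono' (by fun_prop)
    (Eventually.of_forall fun t => ?_)
  rw [norm_pow, Real.norm_eq_abs, Pi.add_apply, pow_mul', ← sq_abs, abs_pow]
  nlinarith [sq_nonneg (|t| ^ n - 1)]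

theorem integral_even_pow (hP : P.IsSpectralMeasureOf T) (hT : IsSymmetricOperator T)
    (x : ℕ → T.domain)
    (hx : ∀ n, (x (n + 1) : H) = T (x n)) (n : ℕ) :
    ((∫ t, t ^ (2 * n) ∂(P.measure (x 0 : H)) : ℝ) : ℂ) = ⟪(x n : H), (x n : H)⟫_ℂ := by
  have h : ∫ _, (1 : ℝ) ∂(P.measure (x n : H)) = ‖(x n : H)‖ ^ 2 := by
    simp [P.measureReal_univ]
  rw [hP.measure_orbit hT x hx, integral_withDensity_eq_integral_toReal_smul (by fun_prop)
    (by simp)] at h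
  have h' : ⟪(x n : H), (x n : H)⟫_ℂ = ((‖(x n : H)‖ ^ 2 : ℝ) : ℂ) := by
    rw [inner_self_eq_norm_sq_to_K]
    push_cast
    rfl
  rw [h', ← h]
  congr 2 with t
  rw [ENNReal.toReal_ofReal (by rw [pow_mul]; positivity), smul_eq_mul, mul_one]

theorem integral_odd_pow (hP : P.IsSpectralMeasureOf T) (hT : IsSymmetricOperator T)
    (x : ℕ → T.domain)
    (hx : ∀ n, (x (n + 1) : H) = T (x n)) (n : ℕ) :
    ((∫ t, t ^ (2 * n + 1) ∂(P.measure (x 0 : H)) : ℝ) : ℂ) =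
      ⟪(x n : H), (x (n + 1) : H)⟫_ℂ := by
  rw [hx, hP.inner_apply, hP.measure_orbit hT x hx n,
    integral_withDensity_eq_integral_toReal_smul (by fun_prop) (by simp)]
  congr 2 with t
  rw [ENNReal.toReal_ofReal (by rw [pow_mul]; positivity), smul_eq_mul, pow_succ]

end PVM.IsSpectralMeasureOf

end PVMCalculus

/-! ### Determinacy of the moment problem under geometric growth -/

section Moments

open Filter Topology

/-- Chebyshev's inequality bounds the mass outside the interval by `K (r/(r+1))^(2n)`. The radius `r
+ 1` instead of `r` makes this tend to zero. -/
theorem ae_mem_Icc_of_moment_bound {μ : Measure ℝ} [IsFiniteMeasure μ]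
    (hint : ∀ n : ℕ, Integrable (fun t : ℝ => t ^ n) μ) {K r : ℝ} (hr : 0 ≤ r)
    (hb : ∀ n : ℕ, ∫ t, t ^ (2 * n) ∂μ ≤ K * r ^ (2 * n)) :
    ∀ᵐ t ∂μ, t ∈ Set.Icc (-(r + 1)) (r + 1) := by
  set S : Set ℝ := {t | t ∈ Set.Icc (-(r + 1)) (r + 1)}ᶜ with hS
  have hSm : MeasurableSet S := measurableSet_Icc.compl
  have hM : 0 < r + 1 := by positivity
  have hle : ∀ n : ℕ, μ.real S ≤ K * ((r / (r + 1)) ^ 2) ^ n := fun n => by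
    have h1 : (r + 1) ^ (2 * n) * μ.real S ≤ ∫ t, t ^ (2 * n) ∂μ := by
      calc (r + 1) ^ (2 * n) * μ.real S = ∫ _ in S, (r + 1) ^ (2 * n) ∂μ := by simp [mul_comm]
        _ ≤ ∫ t in S, t ^ (2 * n) ∂μ := by
          refine setIntegral_mono_on (integrable_const _) (hint _).restrict hSm fun t ht => ?_
          have h2 : r + 1 < |t| := by
            rw [← not_le]
            exact fun h => ht (abs_le.1 h)
          rw [← (even_two_mul n).pow_abs t]
          exact pow_le_pow_left₀ hM.le h2.le _
        _ ≤ ∫ t, t ^ (2 * n) ∂μ :=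
          setIntegral_le_integral (hint _)
            (Eventually.of_forall fun t => (even_two_mul n).pow_nonneg t)
    rw [← pow_mul, div_pow, ← mul_div_assoc, le_div_iff₀ (by positivity), mul_comm]
    exact h1.trans (hb n)
  have hq : (r / (r + 1)) ^ 2 < 1 := by
    refine pow_lt_one₀ (by positivity) ?_ two_ne_zero
    rw [div_lt_one hM]
    linarith
  have hlim := (tendsto_pow_atTop_nhds_zero_of_lt_one (by positivity) hq).const_mul K
  rw [mul_zero] at hlim
  have h0 : μ.real S ≤ 0 := ge_of_tendsto' hlim hle
  rw [ae_iff]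
  exact (measureReal_eq_zero_iff).1 (le_antisymm h0 measureReal_nonneg)

/-- A measure whose even moments grow at most geometrically is determined by its moments. -/
theorem Measure.ext_of_moments {μ ν : Measure ℝ}
    (hμ : ∀ n : ℕ, Integrable (fun t : ℝ => t ^ n) μ)
    (hν : ∀ n : ℕ, Integrable (fun t : ℝ => t ^ n) ν)
    (heq : ∀ n : ℕ, ∫ t, t ^ n ∂μ = ∫ t, t ^ n ∂ν) {K r : ℝ} (hr : 0 ≤ r)
    (hb : ∀ n : ℕ, ∫ t, t ^ (2 * n) ∂μ ≤ K * r ^ (2 * n)) : μ = ν := by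
  have hfin : ∀ {ρ : Measure ℝ}, (∀ n : ℕ, Integrable (fun t : ℝ => t ^ n) ρ) →
      IsFiniteMeasure ρ := fun h => by
    have := h 0
    simpa [integrable_const_iff] using this
  have := hfin hμ
  have := hfin hν
  have hpoly : ∀ {ρ : Measure ℝ}, (∀ n : ℕ, Integrable (fun t : ℝ => t ^ n) ρ) →
      ∀ p : Polynomial ℝ, Integrable (fun t => p.eval t) ρ ∧
        ∫ t, p.eval t ∂ρ = ∑ i ∈ Finset.range (p.natDegree + 1), p.coeff i * ∫ t, t ^ i ∂ρ := by
    intro ρ h p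
    simp only [Polynomial.eval_eq_sum_range]
    refine ⟨integrable_finsetSum _ fun i _ => (h i).const_mul _, ?_⟩
    rw [integral_finsetSum _ fun i _ => (h i).const_mul _]
    exact Finset.sum_congr rfl fun i _ => integral_const_mul _ _
  have happrox : ∀ {ρ : Measure ℝ} [IsFiniteMeasure ρ],
      (∀ n : ℕ, Integrable (fun t : ℝ => t ^ n) ρ) →
      (∀ᵐ t ∂ρ, t ∈ Set.Icc (-(r + 1)) (r + 1)) →
      ∀ (f : BoundedContinuousFunction ℝ ℝ) (p : Polynomial ℝ) (ε : ℝ),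
      (∀ t ∈ Set.Icc (-(r + 1)) (r + 1), |p.eval t - f t| < ε) →
      ‖∫ t, p.eval t ∂ρ - ∫ t, f t ∂ρ‖ ≤ ε * ρ.real Set.univ := by
    intro ρ _ h hs f p ε hp
    rw [← integral_sub (hpoly h p).1 (f.integrable ρ)]
    exact norm_integral_le_of_norm_le_const (hs.mono fun t ht => (hp t ht).le)
  have hsμ := ae_mem_Icc_of_moment_bound hμ hr hb
  -- `ν` inherits the growth bound through its equal moments, so both measures live on one compact
  -- interval and Weierstrass approximation applies.
  have hsν := ae_mem_Icc_of_moment_bound hν hr fun n => (heq _).symm.trans_le (hb n)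
  refine ext_of_forall_integral_eq_of_IsFiniteMeasure fun f => ?_
  refine eq_of_forall_dist_le fun ε hε => ?_
  set C := μ.real Set.univ + ν.real Set.univ + 1 with hC
  have hCpos : 0 < C := by positivity
  obtain ⟨p, hp⟩ := exists_polynomial_near_of_continuousOn (-(r + 1)) (r + 1) f
    f.continuous.continuousOn (ε / C) (by positivity)
  have h1 := happrox hμ hsμ f p _ hp
  have h2 := happrox hν hsν f p _ hp
  have h3 : ∫ t, p.eval t ∂μ = ∫ t, p.eval t ∂ν := by
    rw [(hpoly hμ p).2, (hpoly hν p).2]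
    simp only [heq]
  rw [dist_eq_norm]
  calc ‖∫ t, f t ∂μ - ∫ t, f t ∂ν‖
      = ‖(∫ t, p.eval t ∂ν - ∫ t, f t ∂ν) - (∫ t, p.eval t ∂μ - ∫ t, f t ∂μ)‖ := by
        rw [h3]
        congr 1
        ring
    _ ≤ ε / C * ν.real Set.univ + ε / C * μ.real Set.univ :=
        (norm_sub_le _ _).trans (add_le_add h2 h1)
    _ = ε / C * (C - 1) := by rw [hC]; ring
    _ ≤ ε / C * C := by gcongr; linarith
    _ = ε := div_mul_cancel₀ _ hCpos.ne'

end Moments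

/-! ### Bounded symmetric operators -/

section BoundedSymmetric

open Filter Topology

variable {H : Type v} [NormedAddCommGroup H] [InnerProductSpace ℂ H] [CompleteSpace H]

theorem IsSelfAdjoint.isSymmetricOperator {T : H →ₗ.[ℂ] H} (hT : IsSelfAdjoint T) :
    IsSymmetricOperator T :=
  ⟨hT.dense_domain, hT.inner_symm_apply⟩

theorem IsSymmetricOperator.isClosable {T : H →ₗ.[ℂ] H} (hT : IsSymmetricOperator T) :
    T.IsClosable :=
  (LinearPMap.adjoint_isClosed hT.dense_domain).isClosable.leIsClosable
    (LinearPMap.IsFormalAdjoint.le_adjoint hT.dense_domain hT.hermitian)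

theorem IsSymmetricOperator.exists_seq_of_closure {T : H →ₗ.[ℂ] H} (hT : IsSymmetricOperator T)
    (x : T.closure.domain) : ∃ u : ℕ → T.domain,
      Tendsto (fun n => (u n : H)) atTop (𝓝 x) ∧ Tendsto (fun n => T (u n)) atTop
        (𝓝 (T.closure x)) := by
  have hx := T.closure.mem_graph x
  rw [← hT.isClosable.graph_closure_eq_closure_graph] at hx
  obtain ⟨p, hp, hlim⟩ := mem_closure_iff_seq_limit.1 hx
  have hp' : ∀ n, ∃ u : T.domain, (u : H) = (p n).1 ∧ T u = (p n).2 := fun n =>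
    (LinearPMap.mem_graph_iff _).1 (hp n)
  choose u hu1 hu2 using hp'
  rw [Prod.tendsto_iff] at hlim
  exact ⟨u, by simpa only [hu1] using hlim.1, by simpa only [hu2] using hlim.2⟩

/-- A bounded symmetric operator is essentially selfadjoint. -/
theorem IsSymmetricOperator.isEssentiallySelfAdjoint_of_bound {T : H →ₗ.[ℂ] H}
    (hT : IsSymmetricOperator T) (C : ℝ) (hC : ∀ x : T.domain, ‖T x‖ ≤ C * ‖(x : H)‖) :
    IsEssentiallySelfAdjoint T := by
  -- Every `x` is a limit of domain vectors, and boundedness makes their images Cauchy; the limit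
  -- pair lies in the closed graph.
  have htop : T.closure.domain = ⊤ := by
    rw [Submodule.eq_top_iff']
    intro x
    obtain ⟨u, hu, hlim⟩ := mem_closure_iff_seq_limit.1 (hT.dense_domain x)
    let w : ℕ → T.domain := fun n => ⟨u n, hu n⟩
    have hc : CauchySeq fun n => T (w n) := by
      have hL : LipschitzWith (Real.toNNReal C) (T.toFun : T.domain → H) := by
        refine LipschitzWith.of_dist_le_mul fun y z => ?_
        rw [dist_eq_norm, dist_eq_norm, ← map_sub]
        refine (hC _).trans ?_
        gcongr
        · exact Real.le_coe_toNNReal C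
        · exact le_rfl
      have hw : CauchySeq w := by
        have := hlim.cauchySeq
        rw [Metric.cauchySeq_iff] at this ⊢
        exact this
      exact hL.uniformContinuous.comp_cauchySeq hw
    obtain ⟨y, hy⟩ := cauchySeq_tendsto_of_complete hc
    have hg : (x, y) ∈ T.closure.graph := by
      rw [← hT.isClosable.graph_closure_eq_closure_graph]
      exact mem_closure_of_tendsto (hlim.prodMk_nhds hy)
        (Eventually.of_forall fun n => T.mem_graph (w n))
    exact LinearPMap.mem_domain_of_mem_graph hg
  have hdense : Dense (T.closure.domain : Set H) := by
    rw [htop]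
    exact dense_univ
  have hsymm : T.closure.IsFormalAdjoint T.closure := fun x y => by
    obtain ⟨u, hu1, hu2⟩ := hT.exists_seq_of_closure x
    obtain ⟨w, hw1, hw2⟩ := hT.exists_seq_of_closure y
    refine tendsto_nhds_unique (hu2.inner (𝕜 := ℂ) hw1) ((hu1.inner hw2).congr fun n => ?_)
    exact (hT.hermitian (u n) (w n)).symm
  refine ⟨hT, ?_⟩
  -- The adjoint extends the symmetric closure, which is already everywhere defined, so the two
  -- coincide.
  have hle := LinearPMap.IsFormalAdjoint.le_adjoint hdense hsymm
  refine LinearPMap.isSelfAdjoint_def.2 (LinearPMap.eq_of_le_of_domain_eq hle ?_).symm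
  refine le_antisymm hle.1 ?_
  rw [htop]
  exact le_top

end BoundedSymmetric

/-! ### Moments in a GNS quadruple -/

section GNSMoments

variable {A : Type u} [Ring A] [StarRing A] [Algebra ℂ A] {ω : NonNormalizedState A}
  {H : Type v} [NormedAddCommGroup H] [InnerProductSpace ℂ H] [CompleteSpace H]

namespace GNSQuadruple

variable (Q : GNSQuadruple ω H)

theorem inner_π_left (b : A) (x y : Q.D) :
    ⟪(Q.π b x : H), (y : H)⟫_ℂ = ⟪(x : H), (Q.π (star b) y : H)⟫_ℂ := by
  have hle := Q.star_le_adjoint b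
  have h := LinearPMap.adjoint_isFormalAdjoint (T := operatorOn Q.D (Q.π b)) Q.dense_D
    ⟨y, hle.1 y.2⟩ x
  have h2 : operatorOn Q.D (Q.π (star b)) y = (operatorOn Q.D (Q.π b)).adjoint ⟨y, hle.1 y.2⟩ :=
    hle.2 rfl
  rw [← h2] at h
  rw [← inner_conj_symm, ← inner_conj_symm (x : H)]
  exact congrArg _ h.symm

theorem isSymmetricOperator_op {a : A} (ha : IsSelfAdjoint a) : IsSymmetricOperator (Q.op a) :=
  ⟨Q.dense_D, fun x y => by
    have := Q.inner_π_left a x y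
    rwa [ha.star_eq] at this⟩

theorem inner_π_π (b c : A) :
    ⟪(Q.π b Q.ψ : H), (Q.π c Q.ψ : H)⟫_ℂ = ω (star b * c) := by
  rw [Q.inner_π_left, Q.expectation, map_mul]
  rfl

/-- The vectors `π (aⁿ) ψ` in the domain of the closure of `π (a)`. -/
noncomputable def orbit (a : A) (n : ℕ) : (Q.op a).closure.domain :=
  ⟨Q.π (a ^ n) Q.ψ, (Q.op a).le_closure.1 (Q.π (a ^ n) Q.ψ).2⟩

theorem orbit_succ (a : A) (n : ℕ) :
    (Q.orbit a (n + 1) : H) = (Q.op a).closure (Q.orbit a n) := by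
  have h : Q.op a (Q.π (a ^ n) Q.ψ) = (Q.op a).closure (Q.orbit a n) :=
    (Q.op a).le_closure.2 rfl
  rw [← h]
  change ((Q.π (a ^ (n + 1)) Q.ψ : Q.D) : H) = (Q.π a (Q.π (a ^ n) Q.ψ) : Q.D)
  rw [pow_succ', map_mul]
  rfl

/-- Splitting `aⁿ` as `(a^k)* a^k` or `(a^k)* a^(k+1)` turns `ω (aⁿ)` into an inner product of orbit
vectors, which the spectral measure computes. -/
theorem solvesMomentProblem {a : A} (ha : IsSelfAdjoint a)
    (hQ : IsEssentiallySelfAdjoint (Q.op a)) {P : PVM H}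
    (hP : P.IsSpectralMeasureOf (Q.op a).closure) :
    SolvesMomentProblem ω a (P.measure Q.ψ) := by
  have hT := hQ.closure_selfAdjoint.isSymmetricOperator
  have h0 : (Q.orbit a 0 : H) = Q.ψ := by
    change ((Q.π (a ^ 0) Q.ψ : Q.D) : H) = Q.ψ
    rw [pow_zero, map_one]
    rfl
  rw [← h0]
  refine ⟨hP.integrable_pow hT _ (Q.orbit_succ a), fun n => ?_⟩
  obtain ⟨k, rfl | rfl⟩ := n.even_or_odd'
  · rw [hP.integral_even_pow hT _ (Q.orbit_succ a)]
    refine Eq.trans ?_ (Q.inner_π_π (a ^ k) (a ^ k)).symm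
    rw [star_pow, ha.star_eq, ← pow_add, two_mul]
  · rw [hP.integral_odd_pow hT _ (Q.orbit_succ a)]
    refine Eq.trans ?_ (Q.inner_π_π (a ^ k) (a ^ (k + 1))).symm
    rw [star_pow, ha.star_eq, ← pow_add, two_mul, add_assoc]

end GNSQuadruple

end GNSMoments

/-! ### The C*-algebra case -/

section CStar

variable {A : Type u} [CStarAlgebra A] {ω : NonNormalizedState A}
  {H : Type v} [NormedAddCommGroup H] [InnerProductSpace ℂ H] [CompleteSpace H]

/-- The GNS representation of a C*-algebra is norm-decreasing. -/
theorem GNSQuadruple.norm_π_le (Q : GNSQuadruple ω H) (a : A) (x : Q.D) :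
    ‖(Q.π a x : H)‖ ≤ ‖a‖ * ‖(x : H)‖ := by
  obtain ⟨b, rfl⟩ := Q.cyclic x
  -- Applying `ω (b* · b)` to this identity gives `‖a‖² ‖π(b) ψ‖² - ‖π(a b) ψ‖² = ‖π(c b) ψ‖² ≥ 0`.
  obtain ⟨c, hc⟩ : ∃ c : A, algebraMap ℝ A (‖a‖ ^ 2) - star a * a = star c * c := by
    let _ := CStarAlgebra.spectralOrder A
    let _ := CStarAlgebra.spectralOrderedRing A
    exact CStarAlgebra.nonneg_iff_eq_star_mul_self.1
      (sub_nonneg.2 CStarAlgebra.star_mul_le_algebraMap_norm_sq)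
  have hsq : ∀ d : A, ((‖(Q.π d Q.ψ : H)‖ ^ 2 : ℝ) : ℂ) = ω (star d * d) := fun d => by
    rw [← Q.inner_π_π, inner_self_eq_norm_sq_to_K]
    push_cast
    rfl
  have h1 : star (c * b) * (c * b) =
      ((‖a‖ ^ 2 : ℝ) : ℂ) • (star b * b) - star (a * b) * (a * b) := by
    have : algebraMap ℝ A (‖a‖ ^ 2) = ((‖a‖ ^ 2 : ℝ) : ℂ) • (1 : A) := by
      rw [Algebra.algebraMap_eq_smul_one]
      rfl
    rw [star_mul, star_mul, mul_assoc, ← mul_assoc (star c), ← hc, this]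
    simp [sub_mul, mul_sub, mul_assoc]
  have h2 := congrArg ω.toLinearMap h1
  rw [map_sub, map_smul, ← hsq, ← hsq, ← hsq, smul_eq_mul] at h2
  have h3 : ‖(Q.π (c * b) Q.ψ : H)‖ ^ 2 =
      ‖a‖ ^ 2 * ‖(Q.π b Q.ψ : H)‖ ^ 2 - ‖(Q.π (a * b) Q.ψ : H)‖ ^ 2 := by exact_mod_cast h2
  have h4 : Q.π a (Q.π b Q.ψ) = Q.π (a * b) Q.ψ := by
    rw [map_mul]
    rfl
  rw [h4]
  refine abs_le_of_sq_le_sq' ?_ (by positivity) |>.2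
  rw [mul_pow]
  nlinarith [sq_nonneg ‖(Q.π (c * b) Q.ψ : H)‖]

theorem GNSQuadruple.norm_π_pow_le (Q : GNSQuadruple ω H) (a : A) (x : Q.D) (n : ℕ) :
    ‖(Q.π (a ^ n) x : H)‖ ≤ ‖a‖ ^ n * ‖(x : H)‖ := by
  induction n with
  | zero =>
    rw [pow_zero, pow_zero, map_one, one_mul]
    exact le_rfl
  | succ n ih =>
    have : Q.π (a ^ (n + 1)) x = Q.π a (Q.π (a ^ n) x) := by
      rw [pow_succ', map_mul]
      rfl
    rw [this, pow_succ', mul_assoc]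
    exact (Q.norm_π_le a _).trans (mul_le_mul_of_nonneg_left ih (norm_nonneg a))

theorem GNSQuadruple.isEssentiallySelfAdjoint_op (Q : GNSQuadruple ω H) {a : A}
    (ha : IsSelfAdjoint a) : IsEssentiallySelfAdjoint (Q.op a) :=
  (Q.isSymmetricOperator_op ha).isEssentiallySelfAdjoint_of_bound ‖a‖ (Q.norm_π_le a)

/-- Cauchy-Schwarz and `‖π (a^(2n)) ψ‖ ≤ ‖a‖^(2n) ‖ψ‖` supply the growth bound, with `K = ‖ψ‖²` and
`r = ‖a‖`. -/
theorem GNSQuadruple.moment_unique (Q : GNSQuadruple ω H) {a : A}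
    {μ ν : Measure ℝ} (hμ : SolvesMomentProblem ω a μ) (hν : SolvesMomentProblem ω a ν) :
    μ = ν := by
  refine Measure.ext_of_moments hμ.integrable hν.integrable (fun n => ?_) (norm_nonneg a)
    (K := ‖(Q.ψ : H)‖ ^ 2) fun n => ?_
  · apply Complex.ofReal_injective
    rw [← hμ.moment, ← hν.moment]
  · refine (le_abs_self _).trans ?_
    rw [← Real.norm_eq_abs, ← Complex.norm_real, ← hμ.moment, Q.expectation]
    refine (norm_inner_le_norm _ _).trans ?_
    rw [sq, mul_assoc, mul_comm ‖(Q.ψ : H)‖ (‖a‖ ^ (2 * n))]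
    exact mul_le_mul_of_nonneg_left (Q.norm_π_pow_le a _ _) (norm_nonneg _)

end CStar

theorem proposition2p4 :
    -- (a) unital `*`-algebras
    (∀ (A : Type u) [Ring A] [StarRing A] [Algebra ℂ A] [StarModule ℂ A]
      (ω : NonNormalizedState A) (a : A) (_ha : IsSelfAdjoint a)
      (H : Type v) [NormedAddCommGroup H] [InnerProductSpace ℂ H] [CompleteSpace H]
      (Q : GNSQuadruple ω H) (_hQ : IsEssentiallySelfAdjoint (Q.op a)),
      (∃ P : PVM H, P.IsSpectralMeasureOf (Q.op a).closure) ∧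
      ∀ P : PVM H, P.IsSpectralMeasureOf (Q.op a).closure →
        IsFiniteMeasure (P.measure Q.ψ) ∧ SolvesMomentProblem ω a (P.measure Q.ψ)) ∧
    -- (b) unital C*-algebras
    (∀ (A : Type u) [CStarAlgebra A]
      (ω : NonNormalizedState A) (a : A) (_ha : IsSelfAdjoint a)
      (H : Type v) [NormedAddCommGroup H] [InnerProductSpace ℂ H] [CompleteSpace H]
      (Q : GNSQuadruple ω H),
      IsEssentiallySelfAdjoint (Q.op a) ∧
      ∃ P : PVM H, P.IsSpectralMeasureOf (Q.op a).closure ∧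
        ∀ μ : Measure ℝ, SolvesMomentProblem ω a μ ↔ μ = P.measure Q.ψ) := by
  refine ⟨?_, ?_⟩
  · intro A _ _ _ _ ω a ha H _ _ _ Q hQ
    exact ⟨exists_isSpectralMeasureOf hQ.closure_selfAdjoint, fun P hP =>
      ⟨inferInstance, Q.solvesMomentProblem ha hQ hP⟩⟩
  · intro A _ ω a ha H _ _ _ Q
    have hQ := Q.isEssentiallySelfAdjoint_op ha
    obtain ⟨P, hP⟩ := exists_isSpectralMeasureOf hQ.closure_selfAdjoint
    have hsol := Q.solvesMomentProblem ha hQ hP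
    refine ⟨hQ, P, hP, fun μ => ⟨fun hμ => Q.moment_unique hμ hsol, ?_⟩⟩
    rintro rfl
    exact hsol
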